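/- **Theorem 1.4.** Let $1\le m\le n$, let $(M,g)$ be a compact connected Hermitian manifold of complex dimension $m$, let $(N,h)$ be a Hermitian manifold of complex dimension $n$, and let $f:M\to N$ be holomorphic. *Conventions.* For a Hermitian metric $g$ let $R$ be the curvature tensor of the Chern connection, $$R_{i\bar jk\bar l}=-\frac{\partial^2 g_{k\bar l}}{\partial z^i\partial\bar z^j}+g^{p\bar q}\frac{\partial g_{k\bar q}}{\partial z^i}\frac{\partial g_{p\bar l}}{\partial\bar z^j},$$ let $Ric$ be the first Chern Ricci curvature, $R_{i\bar j}=g^{k\bar l}R_{i\bar jk\bar l}$, and $S=g^{i\bar j}g^{k\bar l}R_{i\bar jk\bar l}$ the Chern scalar curvature. For an $\ell$-dimensional subspace $\Sigma$ of the holomorphic tangent space at $p$, a unitary basis $E_1,\dots,E_\ell$ of $\Sigma$ and $v\in\Sigma$ put $$Ric^{(1)}_\ell(p,\Sigma)(v,\bar v)=\sum_{i=1}^{\ell}R(v,\bar v,E_i,\bar E_i),\qquad Ric^{(2)}_\ell(p,\Sigma)(v,\bar v)=\sum_{i=1}^{\ell}R(E_i,\bar E_i,v,\bar v),\qquad S_\ell(p,\Sigma)=\sum_{i,j=1}^{\ell}R(E_i,\bar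 E_i,E_j,\bar E_j).$$ A sign condition on $Ric^{(1)}_\ell$, $Ric^{(2)}_\ell$ or $S_\ell$ means that for all $p$ and all $\ell$-dimensional $\Sigma$ the Hermitian form on $\Sigma$, respectively the number, has that sign; if $g$ is Kähler, $Ric^{(1)}_\ell=Ric^{(2)}_\ell$ is denoted $Ric_\ell$. The real bisectional curvature is $$\widetilde B(e,a)=\frac1{|a|^2}\sum_{i,j}R(e_i,\bar e_i,e_j,\bar e_j)\,a_ia_j;$$ a sign condition on $\widetilde B$ is required for all unitary frames $e$ at all points and all nonnegative $a=(a_i)\neq 0$. The superscripts $M,N$ say which manifold is meant. The map $f$ is *degenerate* if $\dim_{\mathbb C} f(M)<m$, and $\operatorname{rank}(f)$ is the maximum over $x \in M$ of the complex rank of $\partial f_x:T'_xM\to T'_{f(x)}N$. (a) If $S^M\ge0$ and $Ric^{(1)}_m(N)<0$, or $S^M>0$ and $Ric^{(1)}_m(N)\le0$, then $f$ is degenerate. The same holds if $Ric^M\ge0$ and $S^N_m<0$, or $Ric^M>0$ and $S^N_m\le0$. (b) Let $g$ be Kähler and $1\le\ell<m$. If $S^M_\ell\ge0$ and $Ric^{(1)}_\ell(N)<0$,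 or $S^M_\ell>0$ and $Ric^{(1)}_\ell(N)\le0$, then $\operatorname{rank}(f)<\ell$. The same holds if $Ric^M_\ell\ge0$ and $S^N_\ell<0$, or $Ric^M_\ell>0$ and $S^N_\ell\le0$. (c) Let $1\le\ell\le m$. If $Ric^{(2)}_\ell(M)>0$ and $\widetilde B^N\le0$, or $Ric^{(2)}_\ell(M)\ge0$ and $\widetilde B^N<0$, then $f$ is constant. -/

import Mathlib

open scoped Manifold ContDiff

noncomputable section

namespace Herm

/-- Complex coordinate space of dimension `m`. -/
abbrev Cn (m : ℕ) : Type := EuclideanSpace ℂ (Fin m)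

/-- The `k`-th standard basis vector of `ℂ^m`. -/
abbrev stdVec {m : ℕ} (k : Fin m) : Cn m := EuclideanSpace.single k (1 : ℂ)

/-- The Wirtinger derivative `∂F/∂z^k = (1/2) (∂F/∂x^k - i ∂F/∂y^k)`. -/
def dz {m : ℕ} (k : Fin m) (F : Cn m → ℂ) (z : Cn m) : ℂ :=
  (1 / 2 : ℂ) *
    (fderiv ℝ F z (stdVec k) - Complex.I * fderiv ℝ F z (Complex.I • stdVec k))

/-- The Wirtinger derivative `∂F/∂z̄^k = (1/2) (∂F/∂x^k + i ∂F/∂y^k)`. -/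
def dzbar {m : ℕ} (k : Fin m) (F : Cn m → ℂ) (z : Cn m) : ℂ :=
  (1 / 2 : ℂ) *
    (fderiv ℝ F z (stdVec k) + Complex.I * fderiv ℝ F z (Complex.I • stdVec k))

section Metric

variable (m : ℕ) (M : Type*) [TopologicalSpace M] [ChartedSpace (Cn m) M]

/-- The holomorphic tangent space `T'_p M` of a complex manifold of dimension `m`. -/
abbrev Tan (p : M) : Type := TangentSpace 𝓘(ℂ, Cn m) p

variable {m M}

/-- The coordinate vector field `∂/∂z^k` of the chart `e`, at the point with coordinates `z`. -/
def coordVec (e : OpenPartialHomeomorph M (Cn m)) (z : Cn m) (k : Fin m) : Tan m M (e.symm z) :=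
  mfderiv 𝓘(ℂ, Cn m) 𝓘(ℂ, Cn m) e.symm z (stdVec k : Cn m)

/-- The `k`-th component of a tangent vector with respect to the coordinates of the chart `e`. -/
def coordComp (e : OpenPartialHomeomorph M (Cn m)) (p : M) (v : Tan m M p) (k : Fin m) : ℂ :=
  (EuclideanSpace.proj k : Cn m →L[ℂ] ℂ) (mfderiv 𝓘(ℂ, Cn m) 𝓘(ℂ, Cn m) e p v)

variable (m M)

/-- A Hermitian metric on a complex manifold: a positive definite Hermitian form on every
holomorphic tangent space (linear in the first, conjugate linear in the second variable), whose
coefficients `g_{k l̄}` in the charts of the atlas are smooth in the real sense. -/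
structure HermitianMetric where
  toForm : ∀ p : M, Tan m M p →ₗ[ℂ] Tan m M p →ₗ⋆[ℂ] ℂ
  conj_symm : ∀ (p : M) (u v : Tan m M p), toForm p v u = star (toForm p u v)
  pos : ∀ (p : M) (v : Tan m M p), v ≠ 0 → 0 < (toForm p v v).re
  smooth : ∀ e ∈ atlas (Cn m) M, ∀ k l : Fin m,
    ContDiffOn ℝ ∞ (fun z => toForm (e.symm z) (coordVec e z k) (coordVec e z l)) e.target

variable {m M}

/-- The matrix `(g_{k l̄})` of the metric in the chart `e`, as a function of the coordinates. -/
def coeff (g : HermitianMetric m M) (e : OpenPartialHomeomorph M (Cn m)) (z : Cn m) :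
    Matrix (Fin m) (Fin m) ℂ :=
  Matrix.of fun k l => g.toForm (e.symm z) (coordVec e z k) (coordVec e z l)

/-- The inverse coefficients `g^{p q̄}`, normalised by `∑_q g^{p q̄} g_{l q̄} = δ_{pl}`. -/
def invCoeff (g : HermitianMetric m M) (e : OpenPartialHomeomorph M (Cn m)) (z : Cn m)
    (p q : Fin m) : ℂ :=
  (coeff g e z)⁻¹ q p

/-- The real-linear form `dz^k`. -/
def formDz {m : ℕ} (k : Fin m) : Cn m →L[ℝ] ℂ :=
  (EuclideanSpace.proj k : Cn m →L[ℂ] ℂ).restrictScalars ℝ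

/-- The real-linear form `dz̄^k`. -/
def formDzbar {m : ℕ} (k : Fin m) : Cn m →L[ℝ] ℂ :=
  (Complex.conjCLE : ℂ →L[ℝ] ℂ).comp (formDz k)

/-- The two-form `dz^k ∧ dz̄^l`. -/
def wedgeForm {m : ℕ} (k l : Fin m) : Cn m [⋀^Fin 2]→L[ℝ] ℂ :=
  ContinuousMultilinearMap.alternatization
    ((ContinuousMultilinearMap.mkPiAlgebra ℝ (Fin 2) ℂ).compContinuousLinearMap
      ![formDz k, formDzbar l])

/-- The metric form `ω = √-1 ∑ g_{k l̄} dz^k ∧ dz̄^l` in the chart `e`. -/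
def metricForm (g : HermitianMetric m M) (e : OpenPartialHomeomorph M (Cn m)) (z : Cn m) :
    Cn m [⋀^Fin 2]→L[ℝ] ℂ :=
  Complex.I • ∑ k, ∑ l, coeff g e z k l • wedgeForm k l

/-- The metric is Kähler: `dω = 0`. -/
def IsKahler (g : HermitianMetric m M) : Prop :=
  ∀ e ∈ atlas (Cn m) M, ∀ z ∈ e.target, extDeriv (metricForm g e) z = 0

/-- The components
`R_{i j̄ k l̄} = - ∂²g_{k l̄}/∂z^i∂z̄^j + ∑ g^{p q̄} (∂g_{k q̄}/∂z^i) (∂g_{p l̄}/∂z̄^j)`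
of the curvature of the Chern connection in the chart `e`. -/
def chernComp (g : HermitianMetric m M) (e : OpenPartialHomeomorph M (Cn m)) (z : Cn m)
    (i j k l : Fin m) : ℂ :=
  - dz i (fun w => dzbar j (fun w' => coeff g e w' k l) w) z
    + ∑ p, ∑ q, invCoeff g e z p q *
        dz i (fun w => coeff g e w k q) z * dzbar j (fun w => coeff g e w p l) z

/-- The Chern curvature tensor `R(X, Ȳ, Z, W̄)` at `p`, computed in the preferred chart at `p`. -/
def chern (g : HermitianMetric m M) (p : M) (X Y Z W : Tan m M p) : ℂ :=
  ∑ i, ∑ j, ∑ k, ∑ l,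
    chernComp g (chartAt (Cn m) p) (chartAt (Cn m) p p) i j k l *
      coordComp (chartAt (Cn m) p) p X i * star (coordComp (chartAt (Cn m) p) p Y j) *
      coordComp (chartAt (Cn m) p) p Z k * star (coordComp (chartAt (Cn m) p) p W l)

/-- The (first) Chern Ricci curvature `Ric(v, v̄) = ∑ R_{i j̄} v^i v̄^j`, where
`R_{i j̄} = ∑ g^{k l̄} R_{i j̄ k l̄}`. It is a real number. -/
def ricci (g : HermitianMetric m M) (p : M) (v : Tan m M p) : ℝ :=
  (∑ i, ∑ j, (∑ k, ∑ l,
    invCoeff g (chartAt (Cn m) p) (chartAt (Cn m) p p) k l *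
      chernComp g (chartAt (Cn m) p) (chartAt (Cn m) p p) i j k l) *
    coordComp (chartAt (Cn m) p) p v i * star (coordComp (chartAt (Cn m) p) p v j)).re

/-- The Chern scalar curvature `S = ∑ g^{i j̄} g^{k l̄} R_{i j̄ k l̄}`. It is a real number. -/
def scalar (g : HermitianMetric m M) (p : M) : ℝ :=
  (∑ i, ∑ j, ∑ k, ∑ l,
    invCoeff g (chartAt (Cn m) p) (chartAt (Cn m) p p) i j *
    invCoeff g (chartAt (Cn m) p) (chartAt (Cn m) p p) k l *
      chernComp g (chartAt (Cn m) p) (chartAt (Cn m) p p) i j k l).re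

/-- `E` is a unitary family of tangent vectors at `p`. -/
def IsUnitary (g : HermitianMetric m M) (p : M) {ℓ : ℕ} (E : Fin ℓ → Tan m M p) : Prop :=
  ∀ i j, g.toForm p (E i) (E j) = if i = j then 1 else 0

/-- `E` is a unitary basis of the subspace `Σ` of the tangent space at `p`. -/
def IsUnitaryBasis (g : HermitianMetric m M) (p : M) (Sg : Submodule ℂ (Tan m M p)) {ℓ : ℕ}
    (E : Fin ℓ → Tan m M p) : Prop :=
  IsUnitary g p E ∧ Submodule.span ℂ (Set.range E) = Sg

/-- `Ric_ℓ^{(1)}(p, Σ)(v, v̄) = ∑_i R(v, v̄, E_i, Ē_i)` for a unitary basis `E` of `Σ`. -/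
def ric1 (g : HermitianMetric m M) (p : M) {ℓ : ℕ} (E : Fin ℓ → Tan m M p) (v : Tan m M p) : ℝ :=
  (∑ i, chern g p v v (E i) (E i)).re

/-- `Ric_ℓ^{(2)}(p, Σ)(v, v̄) = ∑_i R(E_i, Ē_i, v, v̄)` for a unitary basis `E` of `Σ`. -/
def ric2 (g : HermitianMetric m M) (p : M) {ℓ : ℕ} (E : Fin ℓ → Tan m M p) (v : Tan m M p) : ℝ :=
  (∑ i, chern g p (E i) (E i) v v).re

/-- `S_ℓ(p, Σ) = ∑_{i,j} R(E_i, Ē_i, E_j, Ē_j)` for a unitary basis `E` of `Σ`. -/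
def scal (g : HermitianMetric m M) (p : M) {ℓ : ℕ} (E : Fin ℓ → Tan m M p) : ℝ :=
  (∑ i, ∑ j, chern g p (E i) (E i) (E j) (E j)).re

/-- The real bisectional curvature
`B̃(e, a) = |a|⁻² ∑_{i,j} R(e_i, ē_i, e_j, ē_j) a_i a_j` of a unitary frame `e` at `p`. -/
def realBisec (g : HermitianMetric m M) (p : M) (e : Fin m → Tan m M p) (a : Fin m → ℝ) : ℝ :=
  (1 / ∑ i, a i ^ 2) * ∑ i, ∑ j, (chern g p (e i) (e i) (e j) (e j)).re * a i * a j

/-! Sign conditions. The predicate `P : ℝ → Prop` is one of `0 < ·`, `0 ≤ ·`, `· < 0`, `· ≤ 0`. -/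

/-- The Chern scalar curvature has the sign `P` at every point. -/
def ScalarSign (g : HermitianMetric m M) (P : ℝ → Prop) : Prop :=
  ∀ p : M, P (scalar g p)

/-- The Chern Ricci curvature has the sign `P`, as a Hermitian form at every point. -/
def RicciSign (g : HermitianMetric m M) (P : ℝ → Prop) : Prop :=
  ∀ (p : M) (v : Tan m M p), v ≠ 0 → P (ricci g p v)

/-- `Ric_ℓ^{(1)}` has the sign `P`: for all points `p` and all `ℓ`-dimensional subspaces `Σ` of the
tangent space at `p`, the Hermitian form `Ric_ℓ^{(1)}(p, Σ)` on `Σ` has the sign `P`. -/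
def Ric1Sign (g : HermitianMetric m M) (ℓ : ℕ) (P : ℝ → Prop) : Prop :=
  ∀ (p : M) (Sg : Submodule ℂ (Tan m M p)), Module.finrank ℂ Sg = ℓ →
    ∀ E : Fin ℓ → Tan m M p, IsUnitaryBasis g p Sg E → ∀ v ∈ Sg, v ≠ 0 → P (ric1 g p E v)

/-- `Ric_ℓ^{(2)}` has the sign `P`: for all points `p` and all `ℓ`-dimensional subspaces `Σ` of the
tangent space at `p`, the Hermitian form `Ric_ℓ^{(2)}(p, Σ)` on `Σ` has the sign `P`. -/
def Ric2Sign (g : HermitianMetric m M) (ℓ : ℕ) (P : ℝ → Prop) : Prop :=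
  ∀ (p : M) (Sg : Submodule ℂ (Tan m M p)), Module.finrank ℂ Sg = ℓ →
    ∀ E : Fin ℓ → Tan m M p, IsUnitaryBasis g p Sg E → ∀ v ∈ Sg, v ≠ 0 → P (ric2 g p E v)

/-- `S_ℓ` has the sign `P`: so does `S_ℓ(p, Σ)` for all points `p` and all `ℓ`-dimensional
subspaces `Σ` of the tangent space at `p`. -/
def ScalSign (g : HermitianMetric m M) (ℓ : ℕ) (P : ℝ → Prop) : Prop :=
  ∀ (p : M) (Sg : Submodule ℂ (Tan m M p)), Module.finrank ℂ Sg = ℓ →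
    ∀ E : Fin ℓ → Tan m M p, IsUnitaryBasis g p Sg E → P (scal g p E)

/-- The real bisectional curvature has the sign `P`: so does `B̃(e, a)` for all points, all unitary
frames `e`, and all nonnegative `a ≠ 0`. -/
def RealBisecSign (g : HermitianMetric m M) (P : ℝ → Prop) : Prop :=
  ∀ (p : M) (e : Fin m → Tan m M p), IsUnitary g p e →
    ∀ a : Fin m → ℝ, (∀ i, 0 ≤ a i) → 0 < ∑ i, a i ^ 2 → P (realBisec g p e a)

end Metric

section Maps

/-- The set `A` contains a (nonempty) `d`-dimensional complex submanifold piece: the image of a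
nonempty open set of `ℂ^d` under an injective holomorphic immersion. -/
def ContainsPiece {n : ℕ} {N : Type*} [TopologicalSpace N] [ChartedSpace (Cn n) N]
    (A : Set N) (d : ℕ) : Prop :=
  ∃ (U : Set (Cn d)) (φ : Cn d → N), IsOpen U ∧ U.Nonempty ∧
    ContMDiffOn 𝓘(ℂ, Cn d) 𝓘(ℂ, Cn n) ω φ U ∧ Set.InjOn φ U ∧
    (∀ z ∈ U, Function.Injective (mfderiv 𝓘(ℂ, Cn d) 𝓘(ℂ, Cn n) φ z)) ∧ φ '' U ⊆ A

/-- The complex dimension of a subset of a complex manifold: the largest dimension of a complex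
submanifold contained in it (`⊥` for the empty set). For an analytic subset this is its usual
dimension, the dimension at its regular points of highest dimension. -/
def complexDim {n : ℕ} {N : Type*} [TopologicalSpace N] [ChartedSpace (Cn n) N]
    (A : Set N) : WithBot ℕ∞ :=
  ⨆ (d : ℕ) (_ : ContainsPiece (n := n) A d), ((d : ℕ∞) : WithBot ℕ∞)

/-- A map from an `m`-dimensional to an `n`-dimensional complex manifold is degenerate if the
dimension of its image is less than `m`. -/
def IsDegenerate (m n : ℕ) {M N : Type*} [TopologicalSpace N] [ChartedSpace (Cn n) N]
    (f : M → N) : Prop :=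
  complexDim (n := n) (Set.range f) < ((m : ℕ∞) : WithBot ℕ∞)

/-- The rank of a map: the maximum over all points of the complex rank of its tangent map. -/
def mapRank (m n : ℕ) {M N : Type*} [TopologicalSpace M] [ChartedSpace (Cn m) M]
    [TopologicalSpace N] [ChartedSpace (Cn n) N] (f : M → N) : ℕ∞ :=
  ⨆ x : M, (Module.finrank ℂ
    (LinearMap.range (mfderiv 𝓘(ℂ, Cn m) 𝓘(ℂ, Cn n) f x).toLinearMap) : ℕ∞)

end Maps

end Herm

end

/-! Maximise, over all unitary `ℓ`-frames `E` of `M`, the determinant (for (a) and (b)) or the trace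
(for (c)) of the Gram matrix of `∂f(E)`; the maximum is attained because `M` is compact. Move the
maximal frame along a holomorphic disc with direction `v` at its base point. With respect to `g` the
Gram matrix of a suitable holomorphic frame is `1 - R^M(v, v̄) |ζ|² + …`, whereas the mixed
second-order term of the Gram matrix of its image is `-R^N(∂f(v), ∂f(v)‾)` plus a positive
semidefinite matrix. The second-order condition at the maximum, after completing the square, yields
`∑ R^M(v, v̄, E_i, Ē_i) ≤ ∑ R^N(∂f(v), ∂f(v)‾, F_i, F̄_i)` for a unitary frame `F` of the span of
`∂f(E)`, or the same inequality weighted by the eigenvalues of the Gram matrix in the case of the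
trace. Either a single `v` or the sum over a unitary frame contradicts the assumed signs, unless the
maximum vanishes. -/

noncomputable section

namespace Herm

open Asymptotics Filter MeasureTheory Topology Matrix
open scoped ComplexConjugate ComplexOrder MatrixOrder

/-! ### Mixed second-order jets -/

/-- Jets `a + b ζ + b' ζ̄ + c ζ ζ̄` modulo `ζ²` and `ζ̄²`: the first dual unit is `ζ`, the second
one is `ζ̄`. -/
abbrev Jet : Type := DualNumber (DualNumber ℂ)

namespace Jet

open TrivSqZeroExt

/-- The jet `a + b ζ + b' ζ̄ + c ζ ζ̄`. -/
def mk (a b b' c : ℂ) : Jet := inl (inl a + inr b) + inr (inl b' + inr c)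

variable (a b b' c x y y' w : ℂ)

@[simp] lemma fst_fst_mk : (mk a b b' c).fst.fst = a := by simp [mk]

@[simp] lemma snd_fst_mk : (mk a b b' c).fst.snd = b := by simp [mk]

@[simp] lemma fst_snd_mk : (mk a b b' c).snd.fst = b' := by simp [mk]

@[simp] lemma snd_snd_mk : (mk a b b' c).snd.snd = c := by simp [mk]

@[ext] lemma ext {p q : Jet} (h₁ : p.fst.fst = q.fst.fst) (h₂ : p.fst.snd = q.fst.snd)
    (h₃ : p.snd.fst = q.snd.fst) (h₄ : p.snd.snd = q.snd.snd) : p = q :=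
  TrivSqZeroExt.ext (TrivSqZeroExt.ext h₁ h₂) (TrivSqZeroExt.ext h₃ h₄)

lemma mk_zero : mk 0 0 0 0 = 0 := by ext <;> simp

lemma mk_one : mk 1 0 0 0 = 1 := by ext <;> simp

lemma mk_add_mk : mk a b b' c + mk x y y' w = mk (a + x) (b + y) (b' + y') (c + w) := by
  ext <;> simp

lemma mk_mul_mk : mk a b b' c * mk x y y' w =
    mk (a * x) (a * y + b * x) (a * y' + b' * x) (a * w + b * y' + b' * y + c * x) := by
  ext <;> simp
  all_goals ring

lemma sum_mk {ι : Type*} (s : Finset ι) (a b b' c : ι → ℂ) :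
    ∑ i ∈ s, mk (a i) (b i) (b' i) (c i) =
      mk (∑ i ∈ s, a i) (∑ i ∈ s, b i) (∑ i ∈ s, b' i) (∑ i ∈ s, c i) := by
  ext <;> simp [TrivSqZeroExt.fst_sum, TrivSqZeroExt.snd_sum]

/-- The complex conjugate of a jet. -/
def bar (q : Jet) : Jet :=
  mk (conj q.fst.fst) (conj q.snd.fst) (conj q.fst.snd) (conj q.snd.snd)

/-- The linear part of a jet, as a function of `ζ`. -/
def lin (q : Jet) (z : ℂ) : ℂ := q.fst.snd * z + q.snd.fst * conj z

/-- The quadratic part of a jet, with the coefficients `d` of `ζ²` and `e` of `ζ̄²` added. -/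
def quad (q : Jet) (d e z : ℂ) : ℂ := q.snd.snd * (z * conj z) + d * z ^ 2 + e * conj z ^ 2

lemma conj_isBigO : (fun z : ℂ => conj z) =O[𝓝 0] fun z => z :=
  IsBigO.of_bound 1 (.of_forall fun z => by simp)

lemma isBigO_lin (q : Jet) : q.lin =O[𝓝 0] fun z => z :=
  ((isBigO_refl (fun z : ℂ => z) _).const_mul_left _).add
    (conj_isBigO.const_mul_left _)

lemma isLittleO_quad (q : Jet) (d e : ℂ) : q.quad d e =o[𝓝 0] fun z => z := by
  have sq_isLittleO : (fun z : ℂ => z ^ 2) =o[𝓝 0] fun z => z := isLittleO_pow_id one_lt_two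
  have h := (((conj_isBigO.mul (isBigO_refl (fun z : ℂ => z) _)).const_mul_left q.snd.snd).add
    ((isBigO_refl (fun z : ℂ => z ^ 2) _ |>.congr_right fun z => sq z).const_mul_left d)).add
    (((conj_isBigO.mul conj_isBigO).const_mul_left e))
  refine (h.congr (fun z => ?_) fun z => (sq z).symm).trans_isLittleO sq_isLittleO
  simp only [quad]
  ring

end Jet

/-- `f` has the jet `q` at `0`: it agrees with `q`, up to multiples of `ζ²` and `ζ̄²`, to second
order. -/
def HasJet (f : ℂ → ℂ) (q : Jet) : Prop :=
  ∃ d e : ℂ, (fun z => f z - (q.fst.fst + q.lin z + q.quad d e z)) =o[𝓝 0] fun z => z ^ 2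

namespace HasJet

variable {f f' : ℂ → ℂ} {q q' : Jet}

lemma const (c : ℂ) : HasJet (fun _ => c) (Jet.mk c 0 0 0) :=
  ⟨0, 0, by simp [Jet.lin, Jet.quad]⟩

lemma id : HasJet (fun z => z) (Jet.mk 0 1 0 0) :=
  ⟨0, 0, by simp [Jet.lin, Jet.quad]⟩

lemma add (hf : HasJet f q) (hf' : HasJet f' q') : HasJet (f + f') (q + q') := by
  obtain ⟨d, e, hde⟩ := hf
  obtain ⟨d', e', hde'⟩ := hf'
  refine ⟨d + d', e + e', (hde.add hde').congr_left fun z => ?_⟩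
  simp only [Jet.lin, Jet.quad, Pi.add_apply, TrivSqZeroExt.fst_add, TrivSqZeroExt.snd_add]
  ring

lemma neg (hf : HasJet f q) : HasJet (-f) (-q) := by
  obtain ⟨d, e, hde⟩ := hf
  refine ⟨-d, -e, hde.neg_left.congr_left fun z => ?_⟩
  simp only [Jet.lin, Jet.quad, neg_sub, Pi.neg_apply, TrivSqZeroExt.fst_neg,
    TrivSqZeroExt.snd_neg, neg_mul]
  ring

lemma bar (hf : HasJet f q) : HasJet (fun z => conj (f z)) q.bar := by
  obtain ⟨d, e, hde⟩ := hf
  refine ⟨star e, star d, ?_⟩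
  rw [← isLittleO_norm_left] at hde ⊢
  refine hde.congr_left fun z => ?_
  rw [← RCLike.norm_conj]
  simp only [Jet.lin, Jet.quad, map_sub, map_add, map_mul, RingHomCompTriple.comp_apply,
    RingHom.id_apply, map_pow, Jet.bar, Jet.fst_fst_mk, Jet.snd_fst_mk, Jet.fst_snd_mk,
    Jet.snd_snd_mk, RCLike.star_def]
  ring_nf

lemma tendsto (hf : HasJet f q) : Tendsto f (𝓝 0) (𝓝 q.fst.fst) := by
  obtain ⟨d, e, hde⟩ := hf
  have hpoly : Tendsto (fun z => q.fst.fst + q.lin z + q.quad d e z) (𝓝 0) (𝓝 q.fst.fst) := by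
    have hcont : Continuous fun z => q.fst.fst + q.lin z + q.quad d e z := by
      unfold Jet.lin Jet.quad
      fun_prop
    simpa [Jet.lin, Jet.quad] using hcont.tendsto 0
  have hrem := hde.trans_tendsto ((continuous_pow (M := ℂ) 2).tendsto' 0 0 (by simp))
  simpa using hrem.add hpoly

lemma mul (hf : HasJet f q) (hf' : HasJet f' q') : HasJet (f * f') (q * q') := by
  have hbdd := hf'.tendsto.isBigO_one ℂ
  obtain ⟨d, e, hde⟩ := hf
  obtain ⟨d', e', hde'⟩ := hf'
  have hP : (fun z => q.fst.fst + q.lin z + q.quad d e z) =O[𝓝 0] fun _ => (1 : ℂ) :=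
    ((by unfold Jet.lin Jet.quad; fun_prop : Continuous _).tendsto 0).isBigO_one ℂ
  have h₁ := hde.mul_isBigO hbdd
  have h₂ := hP.mul_isLittleO hde'
  have h₃ := q.isBigO_lin.mul_isLittleO (q'.isLittleO_quad d' e')
  have h₄ := (q.isLittleO_quad d e).mul_isBigO
    (q'.isBigO_lin.add (q'.isLittleO_quad d' e').isBigO)
  simp only [mul_one, one_mul, ← sq] at h₁ h₂ h₃ h₄
  refine ⟨q.fst.fst * d' + q.fst.snd * q'.fst.snd + d * q'.fst.fst,
    q.fst.fst * e' + q.snd.fst * q'.snd.fst + e * q'.fst.fst,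
    (((h₁.add h₂).add h₃).add h₄).congr_left fun z => ?_⟩
  simp only [Jet.lin, Jet.quad, Pi.mul_apply, TrivSqZeroExt.fst_mul, TrivSqZeroExt.snd_mul,
    smul_eq_mul, MulOpposite.smul_eq_mul_unop, MulOpposite.unop_op, TrivSqZeroExt.fst_add,
    TrivSqZeroExt.snd_add]
  ring

end HasJet

/-- The functions with a jet, together with their jets, form a ring. -/
def jetRing : Subring ((ℂ → ℂ) × Jet) where
  carrier := {p | HasJet p.1 p.2}
  mul_mem' := HasJet.mul
  add_mem' := HasJet.add
  neg_mem' := HasJet.neg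
  zero_mem' := show HasJet _ _ by simpa only [Jet.mk_zero] using! HasJet.const 0
  one_mem' := show HasJet _ _ by simpa only [Jet.mk_one] using! HasJet.const 1

lemma HasJet.sum {ι : Type*} (s : Finset ι) {f : ι → ℂ → ℂ} {q : ι → Jet}
    (h : ∀ i ∈ s, HasJet (f i) (q i)) : HasJet (fun z => ∑ i ∈ s, f i z) (∑ i ∈ s, q i) := by
  have hmem : HasJet (∑ i ∈ s, (f i, q i)).1 (∑ i ∈ s, (f i, q i)).2 :=
    jetRing.sum_mem (t := s) (f := fun i => (f i, q i)) h
  simpa only [Prod.fst_sum, Prod.snd_sum, Finset.sum_fn] using hmem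

/-- The mean over the four rotations of `z` by powers of `i` kills all terms of second order but
`ζ ζ̄`. -/
lemma HasJet.re_nonneg {f : ℂ → ℂ} {q : Jet} (hf : HasJet f q) (h0 : q.fst.fst.re = 0)
    (hpos : ∀ᶠ z in 𝓝 0, 0 ≤ (f z).re) : 0 ≤ q.snd.snd.re := by
  obtain ⟨d, e, hde⟩ := hf
  set r : ℂ → ℂ := fun z => f z - (q.fst.fst + q.lin z + q.quad d e z) with hr
  have r_rot (c : ℂ) (hc : ‖c‖ = 1) : (fun z => r (c * z)) =o[𝓝 0] fun z => z ^ 2 :=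
    (hde.comp_tendsto ((continuous_const_mul c).tendsto' 0 0 (mul_zero c))).trans_isBigO
      (.of_bound 1 (.of_forall fun z => by simp [hc]))
  have f_rot (c : ℂ) : ∀ᶠ z in 𝓝 0, 0 ≤ (f (c * z)).re :=
    ((continuous_const_mul c).tendsto' 0 0 (mul_zero c)).eventually hpos
  have hsum (z : ℂ) : f (1 * z) + f (-1 * z) + f (Complex.I * z) + f (-Complex.I * z) =
      4 * q.fst.fst + 4 * (‖z‖ ^ 2 : ℝ) * q.snd.snd + (r (1 * z) + r (-1 * z) +
        r (Complex.I * z) + r (-Complex.I * z)) := by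
    rw [Complex.ofReal_pow, ← Complex.mul_conj']
    simp only [hr, Jet.lin, Jet.quad, map_mul, map_neg, map_one, Complex.conj_I]
    linear_combination (-2 * q.snd.snd * z * conj z + 2 * d * z ^ 2 + 2 * e * conj z ^ 2) *
      Complex.I_mul_I
  by_contra! hneg
  have hr4 := (((r_rot 1 (by simp)).add (r_rot (-1) (by simp))).add
    (r_rot Complex.I (by simp))).add (r_rot (-Complex.I) (by simp))
  obtain ⟨z, ⟨hrz, h₁, h₂, h₃, h₄⟩, hz⟩ := (((hr4.bound (neg_pos.2 hneg)).and ((f_rot 1).and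
    ((f_rot (-1)).and ((f_rot Complex.I).and (f_rot (-Complex.I)))))).filter_mono
      (nhdsWithin_le_nhds (s := {0}ᶜ)) |>.and self_mem_nhdsWithin).exists
  have hre := congr_arg Complex.re (hsum z)
  simp only [Complex.add_re, Complex.mul_re, Complex.mul_im, Complex.re_ofNat, Complex.im_ofNat,
    Complex.ofReal_re, Complex.ofReal_im, h0] at hre
  have hre_r := (Complex.re_le_norm _).trans hrz
  simp only [Complex.add_re, norm_pow] at hre_r
  have : 0 < ‖z‖ ^ 2 := pow_pos (norm_pos_iff.2 hz) 2
  nlinarith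

/-- The matrix of jets `A + B ζ + B' ζ̄ + C ζ ζ̄`. -/
def matJet {ι κ : Type*} (A B B' C : Matrix ι κ ℂ) : Matrix ι κ Jet :=
  of fun i j => Jet.mk (A i j) (B i j) (B' i j) (C i j)

/-- The matrix-valued function `G` has the jet `Q` at `0`, entry by entry. -/
def HasMatJet {ι κ : Type*} (G : ℂ → Matrix ι κ ℂ) (Q : Matrix ι κ Jet) : Prop :=
  ∀ i j, HasJet (fun z => G z i j) (Q i j)

section MatJet

variable {ι κ τ : Type*} (A B B' C : Matrix ι κ ℂ)

lemma matJet_mul_matJet [Fintype κ] (X Y Y' Z : Matrix κ τ ℂ) :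
    matJet A B B' C * matJet X Y Y' Z =
      matJet (A * X) (A * Y + B * X) (A * Y' + B' * X) (A * Z + B * Y' + B' * Y + C * X) := by
  ext1 i j
  simp only [matJet, mul_apply, of_apply, Jet.mk_mul_mk, Jet.sum_mk, Finset.sum_add_distrib,
    Matrix.add_apply]

lemma trace_matJet [Fintype ι] (A B B' C : Matrix ι ι ℂ) :
    (matJet A B B' C).trace = Jet.mk A.trace B.trace B'.trace C.trace := by
  simp [Matrix.trace, matJet, Jet.sum_mk]

lemma one_add_smul_matJet [DecidableEq ι] (b b' c : ℂ) (T : Matrix ι ι ℂ) :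
    1 + Jet.mk 0 b b' c • matJet T 0 0 0 = matJet 1 (b • T) (b' • T) (c • T) := by
  ext1 i j
  rw [Matrix.add_apply, Matrix.smul_apply, smul_eq_mul]
  rcases eq_or_ne i j with rfl | hij
  · ext <;> simp [matJet]
  · ext <;> simp [matJet, hij]

lemma hasMatJet_affine : HasMatJet (fun z => A + z • B) (matJet A B 0 0) := fun i j => by
  simpa [Jet.mk_mul_mk, Jet.mk_add_mk] using!
    (HasJet.const (A i j)).add (HasJet.id.mul (HasJet.const (B i j)))

variable {G : ℂ → Matrix ι κ ℂ}

lemma HasMatJet.mul [Fintype κ] {G' : ℂ → Matrix κ τ ℂ} {Q : Matrix ι κ Jet}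
    {Q' : Matrix κ τ Jet} (hG : HasMatJet G Q) (hG' : HasMatJet G' Q') :
    HasMatJet (fun z => G z * G' z) (Q * Q') :=
  fun i j => HasJet.sum _ fun k _ => (hG i k).mul (hG' k j)

lemma HasMatJet.conjTranspose {A B B' C : Matrix ι κ ℂ} (hG : HasMatJet G (matJet A B B' C)) :
    HasMatJet (fun z => (G z)ᴴ) (matJet Aᴴ B'ᴴ Bᴴ Cᴴ) :=
  fun i j => by simpa [matJet, Jet.bar] using (hG j i).bar

lemma HasMatJet.trace [Fintype ι] {G : ℂ → Matrix ι ι ℂ} {Q : Matrix ι ι Jet}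
    (hG : HasMatJet G Q) : HasJet (fun z => (G z).trace) Q.trace :=
  HasJet.sum _ fun i _ => hG i i

lemma HasMatJet.det [Fintype ι] [DecidableEq ι] {G : ℂ → Matrix ι ι ℂ} {Q : Matrix ι ι Jet}
    (hG : HasMatJet G Q) : HasJet (fun z => (G z).det) Q.det := by
  let P : Matrix ι ι jetRing := of fun i j => ⟨(fun z => G z i j, Q i j), hG i j⟩
  have eval_det (z : ℂ) : (P.det : (ℂ → ℂ) × Jet).1 z = (G z).det :=
    ((Pi.evalRingHom (fun _ : ℂ => ℂ) z).comp
      ((RingHom.fst (ℂ → ℂ) Jet).comp jetRing.subtype)).map_det P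
  let jetOf : jetRing →+* Jet := (RingHom.snd (ℂ → ℂ) Jet).comp jetRing.subtype
  have jet_det : (P.det : (ℂ → ℂ) × Jet).2 = Q.det :=
    RingHom.map_det (R := jetRing) (S := Jet) jetOf P
  rw [← jet_det, ← funext eval_det]
  exact P.det.2

/-- The factorisation `(1 + X A⁻¹ ζ) A (1 + W ζ ζ̄) (1 + A⁻¹ Y ζ̄)` reduces the determinant to those
of `1 + t`, `t` infinitesimal. -/
lemma det_matJet [Fintype ι] [DecidableEq ι] {A : Matrix ι ι ℂ} (hA : IsUnit A.det)
    (X Y K : Matrix ι ι ℂ) :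
    (matJet A X Y K).det = Jet.mk A.det (A.det * (A⁻¹ * X).trace) (A.det * (A⁻¹ * Y).trace)
      (A.det * ((A⁻¹ * (K - X * A⁻¹ * Y)).trace + (A⁻¹ * X).trace * (A⁻¹ * Y).trace)) := by
  have det_one_add (p : Jet) (hp : p ^ 2 = 0) (T : Matrix ι ι ℂ) :
      (1 + p • matJet T 0 0 0).det = 1 + Jet.mk T.trace 0 0 0 * p := by
    rw [det_one_add_smul, hp, trace_matJet]
    simp
  have hfactor : matJet A X Y K = (1 + Jet.mk 0 1 0 0 • matJet (X * A⁻¹) 0 0 0) *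
      matJet A 0 0 0 * (1 + Jet.mk 0 0 0 1 • matJet (A⁻¹ * (K - X * A⁻¹ * Y)) 0 0 0) *
      (1 + Jet.mk 0 0 1 0 • matJet (A⁻¹ * Y) 0 0 0) := by
    simp only [one_add_smul_matJet, matJet_mul_matJet]
    simp [mul_assoc, nonsing_inv_mul _ hA, mul_nonsing_inv_cancel_left _ _ hA]
  let incl : ℂ →+* Jet :=
    (TrivSqZeroExt.inlHom (DualNumber ℂ) (DualNumber ℂ)).comp (TrivSqZeroExt.inlHom ℂ ℂ)
  have incl_apply (a : ℂ) : incl a = Jet.mk a 0 0 0 := by ext <;> simp [incl]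
  have hdet : (matJet A 0 0 0).det = Jet.mk A.det 0 0 0 := by
    rw [← incl_apply, RingHom.map_det (R := ℂ) (S := Jet) incl A]
    exact congr_arg _ (Matrix.ext fun i j => (incl_apply (A i j)).symm)
  rw [hfactor, det_mul, det_mul, det_mul, hdet, det_one_add, det_one_add, det_one_add,
    trace_mul_comm X]
  · ext <;> simp
    all_goals ring
  all_goals ext <;> simp [sq]

end MatJet

/-! ### Jets along holomorphic discs -/

lemma taylor_two {V W : Type*} [NormedAddCommGroup V] [NormedSpace ℝ V] [NormedAddCommGroup W]
    [NormedSpace ℝ W] {f : V → W} {x₀ : V} (hf : ContDiffAt ℝ 2 f x₀) :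
    (fun x => f x - f x₀ - fderiv ℝ f x₀ (x - x₀)
      - (1 / 2 : ℝ) • fderiv ℝ (fderiv ℝ f) x₀ (x - x₀) (x - x₀)) =o[𝓝 x₀]
      fun x => ‖x - x₀‖ ^ 2 := by
  have hsymm : IsSymmSndFDerivAt ℝ f x₀ := hf.isSymmSndFDerivAt (by simp)
  set A := fderiv ℝ f x₀
  set B := fderiv ℝ (fderiv ℝ f) x₀
  obtain ⟨δ, hδ, hball⟩ := Metric.eventually_nhds_iff_ball.1
    ((hf.eventually (by simp)).mono fun x hx => hx.differentiableAt two_ne_zero)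
  have hder (x) (hx : x ∈ Metric.ball x₀ δ) : HasFDerivWithinAt
      (fun x => f x - f x₀ - A (x - x₀) - (1 / 2 : ℝ) • B (x - x₀) (x - x₀))
      (fderiv ℝ f x - A - B (x - x₀)) (Metric.ball x₀ δ) x := by
    have hsub : HasFDerivAt (fun x => x - x₀) (ContinuousLinearMap.id ℝ V) x :=
      (hasFDerivAt_id x).sub_const x₀
    have hquad := (B.hasFDerivAt.comp x hsub).clm_apply hsub
    refine ((((hball x hx).hasFDerivAt.sub_const (f x₀)).sub (A.hasFDerivAt.comp x hsub)).sub
      (hquad.const_smul (1 / 2 : ℝ))).congr_fderiv ?_ |>.hasFDerivWithinAt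
    ext v
    have hcomm : B v (x - x₀) = B (x - x₀) v := hsymm v (x - x₀)
    simp only [_root_.sub_apply, ContinuousLinearMap.comp_apply, _root_.smul_apply,
      _root_.add_apply, ContinuousLinearMap.flip_apply, ContinuousLinearMap.id_apply,
      Function.comp_apply, hcomm, ← two_smul ℝ, smul_smul]
    norm_num
  have hlo : (fun x => fderiv ℝ f x - A - B (x - x₀)) =o[𝓝[Metric.ball x₀ δ] x₀]
      fun x => ‖x - x₀‖ ^ 1 := by
    have hB : HasFDerivAt (fderiv ℝ f) B x₀ :=
      ((hf.fderiv_right (m := 1) (by norm_num)).differentiableAt one_ne_zero).hasFDerivAt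
    simpa using hB.isLittleO.norm_right.mono nhdsWithin_le_nhds
  simpa [nhdsWithin_eq_nhds.2 (Metric.ball_mem_nhds x₀ hδ)] using
    (convex_ball x₀ δ).isLittleO_pow_succ (Metric.mem_ball_self hδ) hder hlo

section RealLinear

variable {V : Type*} [NormedAddCommGroup V] [NormedSpace ℂ V] [NormedSpace ℝ V]
  [IsScalarTower ℝ ℂ V]

lemma smul_eq_re_smul_add_im_smul (z : ℂ) (v : V) :
    z • v = z.re • v + z.im • (Complex.I • v) := by
  conv_lhs => rw [← Complex.re_add_im z, add_smul, mul_smul]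
  rw [← algebraMap_smul ℂ z.re v, ← algebraMap_smul ℂ z.im (Complex.I • v)]
  rfl

lemma map_complex_smul (φ : V →L[ℝ] ℂ) (z : ℂ) (v : V) :
    φ (z • v) = z.re * φ v + z.im * φ (Complex.I • v) := by
  rw [smul_eq_re_smul_add_im_smul, map_add, map_smul, map_smul, Complex.real_smul,
    Complex.real_smul]

/-- The complex linear part of a real linear form. -/
def linPart (φ : V →L[ℝ] ℂ) : V →ₗ[ℂ] ℂ where
  toFun v := (1 / 2 : ℂ) * (φ v - Complex.I * φ (Complex.I • v))
  map_add' u v := by simp only [smul_add, map_add]; ring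
  map_smul' z v := by
    rw [smul_comm, map_complex_smul φ z v, map_complex_smul φ z (Complex.I • v), smul_smul,
      Complex.I_mul_I, neg_one_smul, map_neg, RingHom.id_apply, smul_eq_mul]
    conv_rhs => rw [← Complex.re_add_im z]
    linear_combination (1 / 2 * z.im * φ (Complex.I • v)) * Complex.I_mul_I

/-- The conjugate linear part of a real linear form. -/
def conjPart (φ : V →L[ℝ] ℂ) : V →ₗ⋆[ℂ] ℂ where
  toFun v := (1 / 2 : ℂ) * (φ v + Complex.I * φ (Complex.I • v))
  map_add' u v := by simp only [smul_add, map_add]; ring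
  map_smul' z v := by
    rw [smul_comm, map_complex_smul φ z v, map_complex_smul φ z (Complex.I • v), smul_smul,
      Complex.I_mul_I, neg_one_smul, map_neg, smul_eq_mul]
    conv_rhs => rw [← Complex.re_add_im z]
    simp only [map_add, map_mul, Complex.conj_ofReal, Complex.conj_I]
    linear_combination (1 / 2 * z.im * φ (Complex.I • v)) * Complex.I_mul_I

lemma linPart_add_conjPart (φ : V →L[ℝ] ℂ) (v : V) : linPart φ v + conjPart φ v = φ v := by
  simp only [linPart, conjPart, LinearMap.coe_mk, AddHom.coe_mk]
  ring

lemma map_smul_eq_linPart_add_conjPart (φ : V →L[ℝ] ℂ) (z : ℂ) (v : V) :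
    φ (z • v) = linPart φ v * z + conjPart φ v * conj z := by
  rw [← linPart_add_conjPart, map_smul, map_smulₛₗ, smul_eq_mul, smul_eq_mul, mul_comm,
    mul_comm (conjPart φ v)]

/-- The coefficient `B(v, v̄)` of `ζ ζ̄` in `B(ζ v, ζ v) / 2`, for a symmetric real bilinear form
`B`. -/
def mixedPart (B : V →L[ℝ] V →L[ℝ] ℂ) (v : V) : ℂ :=
  (1 / 2 : ℂ) * (conjPart (B v) v - Complex.I * conjPart (B (Complex.I • v)) v)

lemma half_smul_bilin_smul_smul {B : V →L[ℝ] V →L[ℝ] ℂ} (hB : ∀ u v, B u v = B v u) (v : V) :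
    ∃ d e : ℂ, ∀ z : ℂ, (1 / 2 : ℝ) • B (z • v) (z • v) =
      mixedPart B v * (z * conj z) + d * z ^ 2 + e * conj z ^ 2 := by
  set w := Complex.I • v with hw
  refine ⟨(1 / 8 : ℂ) * (B v v - B w w - 2 * Complex.I * B v w),
    (1 / 8 : ℂ) * (B v v - B w w + 2 * Complex.I * B v w), fun z => ?_⟩
  have hexpand : B (z • v) (z • v) =
      z.re ^ 2 * B v v + 2 * (z.re * z.im) * B v w + z.im ^ 2 * B w w := by
    rw [smul_eq_re_smul_add_im_smul z v, ← hw]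
    simp only [map_add, map_smul, _root_.add_apply, _root_.smul_apply, Complex.real_smul, hB w v]
    ring
  have hmixed : mixedPart B v = (1 / 4 : ℂ) * (B v v + B w w) := by
    simp only [mixedPart, conjPart, LinearMap.coe_mk, AddHom.coe_mk, ← hw, hB w v]
    linear_combination (-1 / 4 * B w w) * Complex.I_mul_I
  have hconj : conj z = z.re - z.im * Complex.I := by apply Complex.ext <;> simp
  rw [hexpand, hmixed, hconj, Complex.real_smul]
  conv_rhs => rw [← Complex.re_add_im z]
  simp only [Complex.add_re, Complex.add_im, Complex.ofReal_re, Complex.ofReal_im, Complex.mul_re,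
    Complex.mul_im, Complex.I_re, Complex.I_im]
  push_cast
  linear_combination (-(B v v - B w w) / 4 * z.im ^ 2 + z.im ^ 2 / 4 * (B v v + B w w)
    + z.re * z.im * B v w) * Complex.I_mul_I

end RealLinear

section Disc

variable {V : Type*} [NormedAddCommGroup V] [NormedSpace ℂ V] {w : ℂ → V} {w₀ w₁ w₂ : V}
  (hw : (fun z : ℂ => w z - (w₀ + z • w₁ + z ^ 2 • w₂)) =o[𝓝 0] fun z => z ^ 2)

include hw

lemma disc_sub_linear_isBigO : (fun z => w z - w₀ - z • w₁) =O[𝓝 0] fun z => z ^ 2 := by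
  have hsq : (fun z : ℂ => z ^ 2 • w₂) =O[𝓝 0] fun z => z ^ 2 :=
    .of_bound ‖w₂‖ (.of_forall fun z => by rw [norm_smul, mul_comm])
  refine (hsq.add hw.isBigO).congr_left fun z => ?_
  abel

lemma disc_sub_isBigO : (fun z => w z - w₀) =O[𝓝 0] fun z => z := by
  have hlin : (fun z : ℂ => z • w₁) =O[𝓝 0] fun z => z :=
    .of_bound ‖w₁‖ (.of_forall fun z => by rw [norm_smul, mul_comm])
  have hrest := (disc_sub_linear_isBigO hw).trans (isLittleO_pow_id one_lt_two).isBigO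
  refine (hlin.add hrest).congr_left fun z => ?_
  abel

lemma tendsto_disc : Tendsto w (𝓝 0) (𝓝 w₀) :=
  tendsto_sub_nhds_zero_iff.1 ((disc_sub_isBigO hw).trans_tendsto tendsto_id)

variable [NormedSpace ℝ V]

lemma bilin_disc_isLittleO (B : V →L[ℝ] V →L[ℝ] ℂ) :
    (fun z => B (w z - w₀) (w z - w₀) - B (z • w₁) (z • w₁)) =o[𝓝 0] fun z => z ^ 2 := by
  have hΔ := disc_sub_isBigO hw
  have hρ := disc_sub_linear_isBigO hw
  have hlin : (fun z : ℂ => z • w₁) =O[𝓝 0] fun z => z :=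
    .of_bound ‖w₁‖ (.of_forall fun z => by rw [norm_smul, mul_comm])
  have hcube : (fun z : ℂ => z ^ 3) =o[𝓝 0] fun z => z ^ 2 := isLittleO_pow_pow (by norm_num)
  have h₁ := B.isBoundedBilinearMap.isBigO_comp.trans (hρ.norm_norm.mul hΔ.norm_norm)
  have h₂ := B.isBoundedBilinearMap.isBigO_comp.trans (hlin.norm_norm.mul hρ.norm_norm)
  simp only [← norm_mul, ← pow_succ, ← pow_succ'] at h₁ h₂
  refine ((h₁.of_norm_right.trans_isLittleO hcube).add
    (h₂.of_norm_right.trans_isLittleO hcube)).congr_left fun z => ?_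
  simp only [map_sub, _root_.sub_apply]
  ring

variable [IsScalarTower ℝ ℂ V]

lemma HasJet.comp_disc {f : V → ℂ} (hf : ContDiffAt ℝ 2 f w₀) :
    HasJet (fun z => f (w z)) (Jet.mk (f w₀) (linPart (fderiv ℝ f w₀) w₁)
      (conjPart (fderiv ℝ f w₀) w₁) (mixedPart (fderiv ℝ (fderiv ℝ f) w₀) w₁)) := by
  set A := fderiv ℝ f w₀
  set B := fderiv ℝ (fderiv ℝ f) w₀
  obtain ⟨d, e, hde⟩ := half_smul_bilin_smul_smul (B := B) (hf.isSymmSndFDerivAt (by simp)) w₁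
  have hremainder : (fun z => f (w z) - f w₀ - A (w z - w₀) -
      (1 / 2 : ℝ) • B (w z - w₀) (w z - w₀)) =o[𝓝 0] fun z => z ^ 2 :=
    ((taylor_two hf).comp_tendsto (tendsto_disc hw)).trans_isBigO
      (by simpa [Function.comp_def] using (disc_sub_isBigO hw).norm_left.pow 2)
  have hlinear : (fun z => A (w z - (w₀ + z • w₁ + z ^ 2 • w₂))) =o[𝓝 0] fun z => z ^ 2 :=
    (A.isBigO_comp _ _).trans_isLittleO hw
  refine ⟨linPart A w₂ + d, conjPart A w₂ + e, ((hremainder.add hlinear).add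
    ((bilin_disc_isLittleO hw B).const_smul_left (1 / 2 : ℝ))).congr_left fun z => ?_⟩
  rw [Pi.smul_apply, smul_sub, hde z]
  simp only [map_sub, map_add, map_smul_eq_linPart_add_conjPart, map_pow, Jet.lin, Jet.quad,
    Jet.fst_fst_mk, Jet.snd_fst_mk, Jet.fst_snd_mk, Jet.snd_snd_mk]
  ring

end Disc

lemma exists_expansion_two_of_analyticAt {V : Type*} [NormedAddCommGroup V] [NormedSpace ℂ V]
    {f : ℂ → V} (hf : AnalyticAt ℂ f 0) : ∃ w₂ : V,
    (fun z : ℂ => f z - (f 0 + z • deriv f 0 + z ^ 2 • w₂)) =o[𝓝 0] fun z => z ^ 2 := by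
  obtain ⟨p, hp⟩ := hf
  refine ⟨p.coeff 2, ?_⟩
  have hrem : (fun z : ℂ => f (0 + z) - p.partialSum 3 z) =O[𝓝 0] fun z => ‖z‖ ^ 3 :=
    hp.isBigO_sub_partialSum_pow 3
  have hcube : (fun z : ℂ => ‖z‖ ^ 3) =o[𝓝 0] fun z => z ^ 2 := by
    rw [← isLittleO_norm_right]
    simp only [norm_pow]
    exact (isLittleO_pow_pow (𝕜 := ℝ) (by norm_num)).comp_tendsto tendsto_norm_zero
  refine (hrem.trans_isLittleO hcube).congr_left fun z => ?_
  rw [FormalMultilinearSeries.partialSum, Finset.sum_range_succ, Finset.sum_range_succ,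
    Finset.sum_range_one]
  simp only [FormalMultilinearSeries.apply_eq_pow_smul_coeff, hp.deriv, hp.coeff_zero]
  simp only [zero_add, one_smul, pow_one, ← hp.coeff_zero ![], FormalMultilinearSeries.coeff]

lemma HasJet.of_analyticAt {f : ℂ → ℂ} (hf : AnalyticAt ℂ f 0) :
    HasJet f (Jet.mk (f 0) (deriv f 0) 0 0) := by
  obtain ⟨d, hd⟩ := exists_expansion_two_of_analyticAt hf
  refine ⟨d, 0, hd.congr_left fun z => ?_⟩
  simp only [smul_eq_mul, Jet.fst_fst_mk, Jet.lin, Jet.snd_fst_mk, Jet.fst_snd_mk, zero_mul,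
    add_zero, Jet.quad, Jet.snd_snd_mk, zero_add, sub_right_inj]
  ring

section Wirtinger

variable {m : ℕ} (F : Cn m → ℂ) (z v : Cn m)

lemma sum_smul_stdVec : ∑ i, v i • (stdVec i : Cn m) = v := by
  ext k
  simp [Pi.single_apply]

lemma sum_mul_dz : ∑ i, v i * dz i F z = linPart (fderiv ℝ F z) v := by
  conv_rhs => rw [← sum_smul_stdVec v, map_sum]
  simp only [map_smul]
  rfl

lemma sum_star_mul_conjPart (φ : Cn m →L[ℝ] ℂ) :
    ∑ i, star (v i) * conjPart φ (stdVec i) = conjPart φ v := by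
  conv_rhs => rw [← sum_smul_stdVec v, map_sum]
  simp only [map_smulₛₗ]
  rfl

lemma sum_star_mul_dzbar : ∑ i, star (v i) * dzbar i F z = conjPart (fderiv ℝ F z) v :=
  sum_star_mul_conjPart v _

variable {F z}

lemma hasFDerivAt_conjPart_fderiv (hF : ContDiffAt ℝ 2 F z) :
    HasFDerivAt (fun w => conjPart (fderiv ℝ F w) v) ((1 / 2 : ℂ) •
      ((fderiv ℝ (fderiv ℝ F) z).flip v +
        Complex.I • (fderiv ℝ (fderiv ℝ F) z).flip (Complex.I • v))) z := by
  have hB : HasFDerivAt (fderiv ℝ F) (fderiv ℝ (fderiv ℝ F) z) z :=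
    ((hF.fderiv_right (m := 1) (by norm_num)).differentiableAt one_ne_zero).hasFDerivAt
  have happly (u : Cn m) : HasFDerivAt (fun w => fderiv ℝ F w u)
      ((fderiv ℝ (fderiv ℝ F) z).flip u) z :=
    (hB.clm_apply (hasFDerivAt_const u z)).congr_fderiv (by ext; simp)
  exact ((happly v).add ((happly (Complex.I • v)).const_smul Complex.I)).const_smul (1 / 2 : ℂ)

lemma sum_mul_dz_dzbar (hF : ContDiffAt ℝ 2 F z) :
    ∑ i, ∑ j, v i * star (v j) * dz i (fun w => dzbar j F w) z =
      mixedPart (fderiv ℝ (fderiv ℝ F) z) v := by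
  have hlin (j : Fin m) : ∑ i, v i * dz i (fun w => dzbar j F w) z =
      (1 / 2 : ℂ) * (conjPart (fderiv ℝ (fderiv ℝ F) z v) (stdVec j) -
        Complex.I * conjPart (fderiv ℝ (fderiv ℝ F) z (Complex.I • v)) (stdVec j)) := by
    rw [sum_mul_dz]
    exact congr_arg (linPart · v) (hasFDerivAt_conjPart_fderiv (stdVec j) hF).fderiv
  calc _ = ∑ j, star (v j) * ∑ i, v i * dz i (fun w => dzbar j F w) z := by
        rw [Finset.sum_comm]
        simp only [Finset.mul_sum]
        exact Finset.sum_congr rfl fun _ _ => Finset.sum_congr rfl fun _ _ => by ring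
    _ = _ := by
        rw [mixedPart, ← sum_star_mul_conjPart, ← sum_star_mul_conjPart v
          (fderiv ℝ (fderiv ℝ F) z (Complex.I • v))]
        simp only [hlin, Finset.mul_sum, ← Finset.sum_sub_distrib]
        exact Finset.sum_congr rfl fun _ _ => by ring

end Wirtinger

/-! ### Second-order conditions for Gram matrices along holomorphic discs -/

/-- The Gram matrix of the rows of `A` with respect to the Hermitian form with matrix `g`. -/
def rowGram {ι κ : Type*} [Fintype κ] (g : Matrix κ κ ℂ) (A : Matrix ι κ ℂ) : Matrix ι ι ℂ :=
  A * g * Aᴴ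

section RowGram

variable {ι κ τ : Type*} [Fintype κ]

lemma rowGram_mul [Fintype τ] (g : Matrix τ τ ℂ) (A : Matrix ι κ ℂ) (B : Matrix κ τ ℂ) :
    rowGram g (A * B) = rowGram (rowGram g B) A := by
  simp only [rowGram, conjTranspose_mul, Matrix.mul_assoc]

lemma re_trace_mul_nonneg {P Q : Matrix κ κ ℂ} (hP : P.PosSemidef) (hQ : Q.PosSemidef) :
    0 ≤ (P * Q).trace.re := by
  classical
  obtain ⟨B, rfl⟩ := CStarAlgebra.nonneg_iff_eq_star_mul_self.mp hP.nonneg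
  rw [star_eq_conjTranspose, Matrix.mul_assoc, trace_mul_comm]
  exact (Complex.nonneg_iff.1 (hQ.mul_mul_conjTranspose_same B).trace_nonneg).1

lemma posSemidef_rowGram [Finite ι] {g : Matrix κ κ ℂ} (hg : g.PosSemidef) (A : Matrix ι κ ℂ) :
    (rowGram g A).PosSemidef :=
  hg.mul_mul_conjTranspose_same A

variable [Fintype ι] [DecidableEq ι]

lemma exists_eq_mul_conjTranspose {G : Matrix ι ι ℂ} (hG : G.PosDef) :
    ∃ S : Matrix ι ι ℂ, IsUnit S.det ∧ G = S * Sᴴ := by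
  obtain ⟨S, rfl⟩ := CStarAlgebra.nonneg_iff_eq_mul_star_self.mp hG.posSemidef.nonneg
  refine ⟨S, ?_, rfl⟩
  have hdet := hG.det_pos.ne'
  rw [det_mul] at hdet
  exact (left_ne_zero_of_mul hdet).isUnit

lemma rowGram_inv_mul {g : Matrix κ κ ℂ} {A : Matrix ι κ ℂ} {S : Matrix ι ι ℂ}
    (hS : IsUnit S.det) (hA : rowGram g A = S * Sᴴ) : rowGram g (S⁻¹ * A) = 1 := by
  have hS' : IsUnit Sᴴ.det := by rwa [det_conjTranspose, isUnit_star]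
  rw [rowGram_mul, hA, rowGram, nonsing_inv_mul_cancel_left _ _ hS, conjTranspose_nonsing_inv,
    mul_nonsing_inv _ hS']

variable {g h : Matrix κ κ ℂ} {A : Matrix ι κ ℂ} {C : ℝ}

lemma two_mul_re_trace_rowGram_le (hg : (rowGram g A).PosDef) (hh : h.PosSemidef)
    (hC : ∀ B : Matrix ι κ ℂ, rowGram g B = 1 → (rowGram h B).trace.re ≤ C) :
    2 * (rowGram h A).trace.re - (rowGram g A * rowGram h A).trace.re ≤ C := by
  obtain ⟨S, hS, hGS⟩ := exists_eq_mul_conjTranspose hg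
  set H := rowGram h (S⁻¹ * A)
  set P := Sᴴ * S with hP
  have hHS : rowGram h A = S * H * Sᴴ := by
    rw [← mul_nonsing_inv_cancel_left S A hS, rowGram_mul, rowGram]
  have hPh : (1 - P)ᴴ = 1 - P := by simp [hP]
  have hsquare : 0 ≤ (((1 - P)ᴴ * (1 - P)) * H).trace.re :=
    re_trace_mul_nonneg (posSemidef_conjTranspose_mul_self _) (posSemidef_rowGram hh _)
  have hexpand : ((1 - P)ᴴ * (1 - P)) * H = H - P * H - P * H + P * (P * H) := by
    rw [hPh]
    noncomm_ring
  have htrace : (S * H * Sᴴ).trace = (P * H).trace := by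
    rw [trace_mul_comm, ← Matrix.mul_assoc]
  have htrace_mul : (S * Sᴴ * (S * H * Sᴴ)).trace = (P * (P * H)).trace := by
    rw [← Matrix.mul_assoc, trace_mul_comm]
    simp only [hP, Matrix.mul_assoc]
  have hH := hC _ (rowGram_inv_mul hS hGS)
  rw [hexpand] at hsquare
  rw [hHS, hGS, htrace, htrace_mul]
  simp only [trace_add, trace_sub, Complex.add_re, Complex.sub_re] at hsquare
  linarith

lemma re_det_rowGram_le (hg : (rowGram g A).PosDef)
    (hC : ∀ B : Matrix ι κ ℂ, rowGram g B = 1 → (rowGram h B).det.re ≤ C) :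
    (rowGram h A).det.re ≤ C * (rowGram g A).det.re := by
  obtain ⟨S, hS, hGS⟩ := exists_eq_mul_conjTranspose hg
  have hHS : rowGram h A = S * rowGram h (S⁻¹ * A) * Sᴴ := by
    conv_lhs => rw [← mul_nonsing_inv_cancel_left S A hS, rowGram_mul, rowGram]
  have hnorm : S.det * Sᴴ.det = (Complex.normSq S.det : ℂ) := by
    rw [det_conjTranspose, Complex.star_def, Complex.mul_conj]
  rw [hGS, det_mul, hnorm, hHS, det_mul, det_mul, mul_right_comm, hnorm, Complex.re_ofReal_mul,
    Complex.ofReal_re, mul_comm C]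
  exact mul_le_mul_of_nonneg_left (hC _ (rowGram_inv_mul hS hGS)) (Complex.normSq_nonneg _)

end RowGram

lemma matJet_mul_mul_conjTranspose {ι κ : Type*} [Fintype κ] [DecidableEq κ] {g : Matrix κ κ ℂ}
    (hdet : IsUnit g.det) (hg : g.IsHermitian) (A D : Matrix ι κ ℂ) (X Q : Matrix κ κ ℂ) :
    matJet A (D - A * (X * g⁻¹)) 0 0 * matJet g X Xᴴ Q * matJet Aᴴ 0 (D - A * (X * g⁻¹))ᴴ 0 =
      matJet (rowGram g A) (D * g * Aᴴ) (A * g * Dᴴ)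
        (rowGram g D - rowGram (X * g⁻¹ * Xᴴ - Q) A) := by
  have hright (B : Matrix ι κ ℂ) : B * g⁻¹ * g = B := by
    rw [Matrix.mul_assoc, nonsing_inv_mul _ hdet, Matrix.mul_one]
  have hleft (B : Matrix κ ι ℂ) : g * (g⁻¹ * B) = B := mul_nonsing_inv_cancel_left _ _ hdet
  simp only [matJet_mul_matJet, rowGram, conjTranspose_sub, conjTranspose_mul,
    conjTranspose_nonsing_inv, hg.eq, Matrix.mul_zero, Matrix.zero_mul, zero_add, add_zero]
  congr 1 <;>
    simp only [Matrix.sub_mul, Matrix.mul_sub, Matrix.add_mul, ← Matrix.mul_assoc, hright] <;>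
    simp only [Matrix.mul_assoc, hleft] <;> abel

section Curvature

variable {m n : ℕ} {ι : Type*}

/-- The matrix `∂_v γ`. -/
def linMat (γ : Cn m → Matrix (Fin m) (Fin m) ℂ) (z v : Cn m) : Matrix (Fin m) (Fin m) ℂ :=
  of fun k l => linPart (fderiv ℝ (fun w => γ w k l) z) v

/-- The matrix `∂̄_v γ`. -/
def conjMat (γ : Cn m → Matrix (Fin m) (Fin m) ℂ) (z v : Cn m) : Matrix (Fin m) (Fin m) ℂ :=
  of fun k l => conjPart (fderiv ℝ (fun w => γ w k l) z) v

/-- The matrix `∂_v ∂̄_v γ`. -/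
def mixedMat (γ : Cn m → Matrix (Fin m) (Fin m) ℂ) (z v : Cn m) : Matrix (Fin m) (Fin m) ℂ :=
  of fun k l => mixedPart (fderiv ℝ (fderiv ℝ (fun w => γ w k l)) z) v

/-- The matrix `∂_v γ γ⁻¹ ∂̄_v γ - ∂_v ∂̄_v γ` of the Hermitian form `R(v, v̄, ·, ·)`, where `R` is
the Chern curvature of the metric with coefficients `γ`. -/
def curvMat (γ : Cn m → Matrix (Fin m) (Fin m) ℂ) (z v : Cn m) : Matrix (Fin m) (Fin m) ℂ :=
  linMat γ z v * (γ z)⁻¹ * conjMat γ z v - mixedMat γ z v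

/-- The functions `γ` are the coefficients of a Hermitian metric of class `C²` near `z₀`. -/
structure IsMetricAt (γ : Cn m → Matrix (Fin m) (Fin m) ℂ) (z₀ : Cn m) : Prop where
  contDiffAt : ∀ k l, ContDiffAt ℝ 2 (fun z => γ z k l) z₀
  posDef : ∀ᶠ z in 𝓝 z₀, (γ z).PosDef

variable {γ : Cn m → Matrix (Fin m) (Fin m) ℂ} {z₀ : Cn m}

namespace IsMetricAt

lemma linMat_conjTranspose (hγ : IsMetricAt γ z₀) (v : Cn m) :
    (linMat γ z₀ v)ᴴ = conjMat γ z₀ v := by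
  ext1 k l
  have hstar : (fun z => γ z k l) =ᶠ[𝓝 z₀] fun z => Complex.conjCLE (γ z l k) :=
    hγ.posDef.mono fun z hz => (hz.isHermitian.apply k l).symm
  have hfderiv : fderiv ℝ (fun z => γ z k l) z₀ =
      (Complex.conjCLE : ℂ →L[ℝ] ℂ).comp (fderiv ℝ (fun z => γ z l k) z₀) := by
    rw [hstar.fderiv_eq]
    exact ((Complex.conjCLE : ℂ →L[ℝ] ℂ).hasFDerivAt.comp z₀
      ((hγ.contDiffAt l k).differentiableAt two_ne_zero).hasFDerivAt).fderiv
  simp [linMat, conjMat, linPart, conjPart, hfderiv]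

variable {w : ℂ → Cn m} {v w₂ : Cn m}
  (hw : (fun z : ℂ => w z - (z₀ + z • v + z ^ 2 • w₂)) =o[𝓝 0] fun z => z ^ 2)

include hw in
lemma hasMatJet_comp_disc (hγ : IsMetricAt γ z₀) : HasMatJet (fun z => γ (w z))
    (matJet (γ z₀) (linMat γ z₀ v) (conjMat γ z₀ v) (mixedMat γ z₀ v)) :=
  fun k l => HasJet.comp_disc hw (hγ.contDiffAt k l)

include hw in
/-- The first-order coefficient is that of the covariant derivative `A₁ + A₀ ∂_v γ γ⁻¹` of the
frame. -/
lemma hasMatJet_rowGram_comp_disc (hγ : IsMetricAt γ z₀) {A : ℂ → Matrix ι (Fin m) ℂ}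
    {A₀ D : Matrix ι (Fin m) ℂ}
    (hA : HasMatJet A (matJet A₀ (D - A₀ * (linMat γ z₀ v * (γ z₀)⁻¹)) 0 0)) :
    HasMatJet (fun z => rowGram (γ (w z)) (A z))
      (matJet (rowGram (γ z₀) A₀) (D * γ z₀ * A₀ᴴ) (A₀ * γ z₀ * Dᴴ)
        (rowGram (γ z₀) D - rowGram (curvMat γ z₀ v) A₀)) := by
  have hdet := hγ.posDef.self_of_nhds.det_pos.ne'.isUnit
  have hjet := (hA.mul (hγ.hasMatJet_comp_disc hw)).mul hA.conjTranspose
  rwa [← hγ.linMat_conjTranspose, conjTranspose_zero,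
    matJet_mul_mul_conjTranspose hdet hγ.posDef.self_of_nhds.isHermitian,
    hγ.linMat_conjTranspose] at hjet

end IsMetricAt

end Curvature

section Bochner

variable {m n : ℕ} {ι : Type*}

/-- The transpose of the Jacobian matrix of `F`, which maps coordinate rows to coordinate rows. -/
def jacobianRow (F : Cn m → Cn n) (z : Cn m) : Matrix (Fin m) (Fin n) ℂ :=
  of fun k l => fderiv ℂ F z (stdVec k) l

section Jacobian

variable {F : Cn m → Cn n} {z₀ : Cn m}

lemma vecMul_jacobianRow (F : Cn m → Cn n) (z v : Cn m) :
    v.ofLp ᵥ* jacobianRow F z = (fderiv ℂ F z v).ofLp := by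
  ext l
  conv_rhs => rw [← sum_smul_stdVec v, map_sum]
  simp [vecMul, dotProduct, jacobianRow]

lemma hasMatJet_jacobianRow (hF : AnalyticAt ℂ F z₀) (v : Cn m) :
    ∃ J₁, HasMatJet (fun z => jacobianRow F (z₀ + z • v)) (matJet (jacobianRow F z₀) J₁ 0 0) := by
  refine ⟨of fun k l => deriv (fun z : ℂ => jacobianRow F (z₀ + z • v) k l) 0, fun k l => ?_⟩
  have hline : AnalyticAt ℂ (fun z : ℂ => z₀ + z • v) 0 := by fun_prop
  have hentry : AnalyticAt ℂ (fun z : Cn m => jacobianRow F z k l) z₀ :=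
    (((EuclideanSpace.proj l : Cn n →L[ℂ] ℂ).comp
      (ContinuousLinearMap.apply ℂ (Cn n) (stdVec k))).analyticAt _).comp hF.fderiv
  simpa [matJet] using! HasJet.of_analyticAt (hentry.comp_of_eq hline (by simp))

lemma exists_disc_expansion (hF : AnalyticAt ℂ F z₀) (v : Cn m) : ∃ w₂ : Cn n,
    (fun z : ℂ => F (z₀ + z • v) - (F z₀ + z • fderiv ℂ F z₀ v + z ^ 2 • w₂)) =o[𝓝 0]
      fun z => z ^ 2 := by
  have hline : AnalyticAt ℂ (fun z : ℂ => z₀ + z • v) 0 := by fun_prop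
  have hderiv : HasDerivAt (F ∘ fun z : ℂ => z₀ + z • v) (fderiv ℂ F z₀ v) 0 := by
    have hline' : HasDerivAt (fun z : ℂ => z₀ + z • v) v 0 := by
      simpa using ((hasDerivAt_id (0 : ℂ)).smul_const v).const_add z₀
    exact hF.differentiableAt.hasFDerivAt.comp_hasDerivAt_of_eq 0 hline' (by simp)
  simpa [hderiv.deriv] using
    exists_expansion_two_of_analyticAt (hF.comp_of_eq hline (by simp : z₀ + (0 : ℂ) • v = z₀))

/-- The frame `A` of the source is normal to second order for `γ`. -/
lemma exists_hasMatJet_rowGram {γ : Cn m → Matrix (Fin m) (Fin m) ℂ}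
    {η : Cn n → Matrix (Fin n) (Fin n) ℂ} (hγ : IsMetricAt γ z₀) (hη : IsMetricAt η (F z₀))
    (hF : AnalyticAt ℂ F z₀) (A₀ : Matrix ι (Fin m) ℂ) (v : Cn m) :
    ∃ (A : ℂ → Matrix ι (Fin m) ℂ) (D : Matrix ι (Fin n) ℂ),
      HasMatJet (fun z => rowGram (γ (z₀ + z • v)) (A z))
        (matJet (rowGram (γ z₀) A₀) 0 0 (-rowGram (curvMat γ z₀ v) A₀)) ∧
      HasMatJet (fun z => rowGram (η (F (z₀ + z • v))) (A z * jacobianRow F (z₀ + z • v)))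
        (matJet (rowGram (η (F z₀)) (A₀ * jacobianRow F z₀))
          (D * η (F z₀) * (A₀ * jacobianRow F z₀)ᴴ) (A₀ * jacobianRow F z₀ * η (F z₀) * Dᴴ)
          (rowGram (η (F z₀)) D - rowGram (curvMat η (F z₀) (fderiv ℂ F z₀ v))
            (A₀ * jacobianRow F z₀))) := by
  obtain ⟨J₁, hJ⟩ := hasMatJet_jacobianRow hF v
  obtain ⟨w₂, hw⟩ := exists_disc_expansion hF v
  set A₁ := -(A₀ * (linMat γ z₀ v * (γ z₀)⁻¹))
  have hA : HasMatJet (fun z => A₀ + z • A₁) (matJet A₀ A₁ 0 0) := hasMatJet_affine A₀ A₁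
  have hAJ := hA.mul hJ
  simp only [matJet_mul_matJet, Matrix.mul_zero, Matrix.zero_mul, add_zero] at hAJ
  refine ⟨fun z => A₀ + z • A₁, A₀ * J₁ + A₁ * jacobianRow F z₀ +
    A₀ * jacobianRow F z₀ * (linMat η (F z₀) (fderiv ℂ F z₀ v) * (η (F z₀))⁻¹), ?_, ?_⟩
  · have hgram := hγ.hasMatJet_rowGram_comp_disc (A₀ := A₀) (D := 0) (w₂ := 0)
      (w := fun z => z₀ + z • v) (v := v) (by simp) (by simpa only [zero_sub] using hA)
    simpa [rowGram] using hgram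
  · exact hη.hasMatJet_rowGram_comp_disc hw (by rwa [add_sub_cancel_right])

end Jacobian

section SecondOrder

variable [Fintype ι] [DecidableEq ι] {G H : ℂ → Matrix ι ι ℂ} {R H₀ X Y K : Matrix ι ι ℂ}
  (hG : HasMatJet G (matJet 1 0 0 (-R))) (hH : HasMatJet H (matJet H₀ X Y K))

include hG hH

lemma re_trace_le_of_trace_max (hmax : ∀ᶠ z in 𝓝 0,
    2 * (H z).trace.re - (G z * H z).trace.re ≤ H₀.trace.re) :
    (R * H₀).trace.re ≤ -K.trace.re := by
  have hjet := (HasJet.const H₀.trace.re).add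
    ((hG.mul hH).trace.add (hH.trace.add hH.trace).neg)
  simp only [matJet_mul_matJet, trace_matJet] at hjet
  have hre := hjet.re_nonneg (by simp) (by
    filter_upwards [hmax] with z hz
    simp only [Pi.add_apply, Pi.neg_apply, Complex.add_re, Complex.neg_re, Complex.ofReal_re]
    linarith)
  simp only [TrivSqZeroExt.snd_add, TrivSqZeroExt.snd_neg, Jet.snd_snd_mk, Matrix.one_mul,
    Matrix.neg_mul, Matrix.zero_mul, trace_add, trace_neg, trace_zero, Complex.add_re,
    Complex.neg_re, Complex.zero_re] at hre
  linarith

lemma re_trace_le_of_det_max (hH₀ : H₀.PosDef) (hXY : Xᴴ = Y)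
    (hmax : ∀ᶠ z in 𝓝 0, (H z).det.re ≤ H₀.det.re * (G z).det.re) :
    R.trace.re ≤ -(H₀⁻¹ * (K - X * H₀⁻¹ * Y)).trace.re := by
  have hdet : (H₀.det.re : ℂ) = H₀.det := Complex.ext rfl (Complex.pos_iff.1 hH₀.det_pos).2
  have hpos : 0 < H₀.det.re := (Complex.pos_iff.1 hH₀.det_pos).1
  have hconj : (H₀⁻¹ * Y).trace = conj (H₀⁻¹ * X).trace := by
    rw [← Complex.star_def, ← trace_conjTranspose, conjTranspose_mul, conjTranspose_nonsing_inv,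
      hH₀.isHermitian.eq, hXY, trace_mul_comm]
  have hjet := ((HasJet.const H₀.det.re).mul hG.det).add hH.det.neg
  rw [det_matJet (by simp), det_matJet hH₀.det_pos.ne'.isUnit] at hjet
  have hre := hjet.re_nonneg (by simp) (by
    filter_upwards [hmax] with z hz
    simp only [Pi.add_apply, Pi.mul_apply, Pi.neg_apply, Complex.add_re, Complex.neg_re,
      Complex.re_ofReal_mul]
    linarith)
  rw [Jet.mk_mul_mk, ← hdet, hconj, Complex.mul_conj] at hre
  simp only [TrivSqZeroExt.snd_add, TrivSqZeroExt.snd_neg, Jet.snd_snd_mk] at hre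
  simp only [trace_zero, det_one, inv_one, sub_zero, mul_zero, add_zero, zero_mul, one_mul,
    trace_neg, mul_neg, Complex.add_re, Complex.neg_re, Complex.re_ofReal_mul,
    Complex.ofReal_re] at hre
  nlinarith [mul_nonneg hpos.le (Complex.normSq_nonneg (H₀⁻¹ * X).trace)]

end SecondOrder

section Inequalities

variable [DecidableEq ι] {γ : Cn m → Matrix (Fin m) (Fin m) ℂ}
  {η : Cn n → Matrix (Fin n) (Fin n) ℂ} {F : Cn m → Cn n} {z₀ : Cn m} {A : Matrix ι (Fin m) ℂ}

lemma IsMetricAt.eventually_posDef_rowGram [Finite ι] (hγ : IsMetricAt γ z₀) {v : Cn m}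
    {A : ℂ → Matrix ι (Fin m) ℂ} {R : Matrix ι ι ℂ}
    (hA : HasMatJet (fun z => rowGram (γ (z₀ + z • v)) (A z)) (matJet 1 0 0 R)) :
    ∀ᶠ z in 𝓝 0, (rowGram (γ (z₀ + z • v)) (A z)).PosDef := by
  cases nonempty_fintype ι
  have hline : Tendsto (fun z : ℂ => z₀ + z • v) (𝓝 0) (𝓝 z₀) :=
    (by fun_prop : Continuous fun z : ℂ => z₀ + z • v).tendsto' _ _ (by simp)
  have hdet := hA.det.tendsto
  rw [det_matJet (by simp), Jet.fst_fst_mk, det_one] at hdet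
  filter_upwards [hline.eventually hγ.posDef, hdet.eventually_ne one_ne_zero] with z hz hz'
  exact (posSemidef_rowGram hz.posSemidef _).posDef_iff_det_ne_zero.2 hz'

variable [Fintype ι] (hγ : IsMetricAt γ z₀) (hη : IsMetricAt η (F z₀)) (hF : AnalyticAt ℂ F z₀)
  (hA : rowGram (γ z₀) A = 1) (v : Cn m)

include hγ hη hF hA

theorem re_trace_curvMat_le_of_trace_max
    (hmax : ∀ᶠ z in 𝓝 z₀, ∀ B : Matrix ι (Fin m) ℂ, rowGram (γ z) B = 1 →
      (rowGram (η (F z)) (B * jacobianRow F z)).trace.re ≤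
        (rowGram (η (F z₀)) (A * jacobianRow F z₀)).trace.re) :
    (rowGram (curvMat γ z₀ v) A * rowGram (η (F z₀)) (A * jacobianRow F z₀)).trace.re ≤
      (rowGram (curvMat η (F z₀) (fderiv ℂ F z₀ v)) (A * jacobianRow F z₀)).trace.re := by
  obtain ⟨B, D, hG, hH⟩ := exists_hasMatJet_rowGram hγ hη hF A v
  rw [hA] at hG
  have hline : Tendsto (fun z : ℂ => z₀ + z • v) (𝓝 0) (𝓝 z₀) :=
    (by fun_prop : Continuous fun z : ℂ => z₀ + z • v).tendsto' _ _ (by simp)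
  have hle := re_trace_le_of_trace_max hG hH (by
    filter_upwards [hγ.eventually_posDef_rowGram hG, hline.eventually hmax,
      hline.eventually (hF.continuousAt.eventually hη.posDef)] with z hGz hmaxz hηz
    simp only [rowGram_mul] at hmaxz ⊢
    exact two_mul_re_trace_rowGram_le hGz (posSemidef_rowGram hηz.posSemidef _) hmaxz)
  have hD : 0 ≤ (rowGram (η (F z₀)) D).trace.re :=
    (Complex.nonneg_iff.1
      (posSemidef_rowGram hη.posDef.self_of_nhds.posSemidef D).trace_nonneg).1
  rw [trace_sub, Complex.sub_re] at hle
  linarith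

theorem re_trace_curvMat_le_of_det_max
    (hH₀ : (rowGram (η (F z₀)) (A * jacobianRow F z₀)).PosDef)
    (hmax : ∀ᶠ z in 𝓝 z₀, ∀ B : Matrix ι (Fin m) ℂ, rowGram (γ z) B = 1 →
      (rowGram (η (F z)) (B * jacobianRow F z)).det.re ≤
        (rowGram (η (F z₀)) (A * jacobianRow F z₀)).det.re) :
    (rowGram (curvMat γ z₀ v) A).trace.re ≤
      ((rowGram (η (F z₀)) (A * jacobianRow F z₀))⁻¹ *
        rowGram (curvMat η (F z₀) (fderiv ℂ F z₀ v)) (A * jacobianRow F z₀)).trace.re := by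
  obtain ⟨B, D, hG, hH⟩ := exists_hasMatJet_rowGram hγ hη hF A v
  rw [hA] at hG
  have hline : Tendsto (fun z : ℂ => z₀ + z • v) (𝓝 0) (𝓝 z₀) :=
    (by fun_prop : Continuous fun z : ℂ => z₀ + z • v).tendsto' _ _ (by simp)
  have hη₀ := hη.posDef.self_of_nhds
  set C := A * jacobianRow F z₀
  set H₀ := rowGram (η (F z₀)) C
  have hle := re_trace_le_of_det_max hG hH hH₀ (by
    simp only [conjTranspose_mul, conjTranspose_conjTranspose, hη₀.isHermitian.eq,
      Matrix.mul_assoc]) (by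
    filter_upwards [hγ.eventually_posDef_rowGram hG, hline.eventually hmax] with z hGz hmaxz
    simp only [rowGram_mul] at hmaxz ⊢
    exact re_det_rowGram_le hGz hmaxz)
  -- The part of `D` orthogonal to the rows of `C` remains after completing the square.
  have hsquare : rowGram (η (F z₀)) D -
      D * η (F z₀) * Cᴴ * H₀⁻¹ * (C * η (F z₀) * Dᴴ) =
        rowGram (η (F z₀)) (D - D * η (F z₀) * Cᴴ * H₀⁻¹ * C) := by
    have hcancel := mul_nonsing_inv_cancel_left H₀ (C * η (F z₀) * Dᴴ) hH₀.det_pos.ne'.isUnit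
    simp only [H₀, rowGram, conjTranspose_sub, conjTranspose_mul, conjTranspose_conjTranspose,
      conjTranspose_nonsing_inv, hη₀.isHermitian.eq, Matrix.mul_sub, Matrix.sub_mul,
      Matrix.mul_assoc] at hcancel ⊢
    rw [hcancel]
    abel
  have hnonneg := re_trace_mul_nonneg hH₀.inv.posSemidef (posSemidef_rowGram hη₀.posSemidef
    (D - D * η (F z₀) * Cᴴ * H₀⁻¹ * C))
  rw [sub_right_comm, hsquare, Matrix.mul_sub, trace_sub, Complex.sub_re] at hle
  linarith

end Inequalities

end Bochner

/-! ### Frames of the tangent spaces -/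

/-- The family of vectors `∑ⱼ Aᵢⱼ Eⱼ`. -/
def frameChange {ι κ V : Type*} [Fintype κ] [AddCommGroup V] [Module ℂ V] (A : Matrix ι κ ℂ)
    (E : κ → V) (i : ι) : V :=
  ∑ j, A i j • E j

section FrameChange

variable {ι κ τ V W : Type*} [Fintype κ] [AddCommGroup V] [Module ℂ V] [AddCommGroup W]
  [Module ℂ W]

lemma frameChange_one [DecidableEq κ] (E : κ → V) : frameChange 1 E = E := by
  ext i
  simp [frameChange, one_apply, ite_smul]

lemma frameChange_mul [Fintype τ] (A : Matrix ι κ ℂ) (B : Matrix κ τ ℂ) (E : τ → V) :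
    frameChange (A * B) E = frameChange A (frameChange B E) := by
  ext i
  simp only [frameChange, mul_apply, Finset.sum_smul, Finset.smul_sum, smul_smul]
  exact Finset.sum_comm

lemma map_comp_frameChange (L : V →ₗ[ℂ] W) (A : Matrix ι κ ℂ) (E : κ → V) :
    L ∘ frameChange A E = frameChange A (L ∘ E) := by
  ext i
  simp [frameChange, map_sum]

lemma frameChange_mem_span (A : Matrix ι κ ℂ) (E : κ → V) (i : ι) :
    frameChange A E i ∈ Submodule.span ℂ (Set.range E) :=
  Submodule.sum_mem _ fun j _ => Submodule.smul_mem _ _ (Submodule.subset_span ⟨j, rfl⟩)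

end FrameChange

section Gram

variable {m : ℕ} {M : Type*} [TopologicalSpace M] [ChartedSpace (Cn m) M] {ι κ : Type*}

/-- The Gram matrix of a family of tangent vectors. -/
def gram (g : HermitianMetric m M) (p : M) (E : ι → Tan m M p) : Matrix ι ι ℂ :=
  of fun i j => g.toForm p (E i) (E j)

/-- The matrix of the Hermitian form `R(v, v̄, ·, ·)` on a family of tangent vectors. -/
def chernMat (g : HermitianMetric m M) (p : M) (v : Tan m M p) (E : ι → Tan m M p) :
    Matrix ι ι ℂ :=
  of fun i j => chern g p v v (E i) (E j)

variable (g : HermitianMetric m M) (p : M)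

lemma gram_isHermitian (E : ι → Tan m M p) : (gram g p E).IsHermitian := by
  ext1 i j
  exact (g.conj_symm p _ _).symm

lemma gram_frameChange [Fintype κ] (A : Matrix ι κ ℂ) (E : κ → Tan m M p) :
    gram g p (frameChange A E) = rowGram (gram g p E) A := by
  ext i j
  simp only [gram, frameChange, rowGram, mul_apply, of_apply, conjTranspose_apply, map_sum,
    LinearMap.sum_apply, map_smul, LinearMap.smul_apply, LinearMap.map_smulₛₗ, smul_eq_mul,
    Finset.mul_sum, Finset.sum_mul]
  exact Finset.sum_congr rfl fun k _ => Finset.sum_congr rfl fun l _ => by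
    rw [starRingEnd_apply]; ring

lemma posDef_gram [Finite κ] {E : κ → Tan m M p} (hE : LinearIndependent ℂ E) :
    (gram g p E).PosDef := by
  cases nonempty_fintype κ
  refine posDef_iff_dotProduct_mulVec.2 ⟨gram_isHermitian g p E, fun x hx => ?_⟩
  let u : Unit → Tan m M p := frameChange (of fun _ => star x) E
  have hu : u () ≠ 0 := fun h => hx (star_eq_zero.1 (funext fun j =>
    Fintype.linearIndependent_iff.1 hE _ h j))
  have hquad : star x ⬝ᵥ (gram g p E *ᵥ x) = gram g p u () () := by
    rw [gram_frameChange, rowGram, mul_apply, dotProduct_mulVec, dotProduct]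
    simp only [conjTranspose_apply, of_apply, Pi.star_apply, star_star]
    rfl
  rw [hquad, Complex.pos_iff]
  exact ⟨g.pos p _ hu, (Complex.conj_eq_iff_im.1 (g.conj_symm p _ _).symm).symm⟩

lemma isUnitary_iff {ℓ : ℕ} {E : Fin ℓ → Tan m M p} : IsUnitary g p E ↔ gram g p E = 1 := by
  simp [IsUnitary, ← Matrix.ext_iff, gram, one_apply]

end Gram

/-! ### Bochner inequalities in charts -/

section Charts

variable {m : ℕ} {M : Type*} [TopologicalSpace M] [ChartedSpace (Cn m) M] {ι κ : Type*}

/-- The coordinates of tangent vectors at `p` in the chart `e`. -/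
def chartCoord (e : OpenPartialHomeomorph M (Cn m)) (p : M) : Tan m M p →ₗ[ℂ] Cn m :=
  (mfderiv 𝓘(ℂ, Cn m) 𝓘(ℂ, Cn m) e p).toLinearMap

/-- The matrix whose rows are the coordinates of a family of tangent vectors. -/
def coordMatrix (e : OpenPartialHomeomorph M (Cn m)) (p : M) (E : ι → Tan m M p) :
    Matrix ι (Fin m) ℂ :=
  of fun i => (chartCoord e p (E i)).ofLp

lemma coordMatrix_frameChange [Fintype κ] (e : OpenPartialHomeomorph M (Cn m)) (p : M)
    (A : Matrix ι κ ℂ) (E : κ → Tan m M p) :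
    coordMatrix e p (frameChange A E) = A * coordMatrix e p E := by
  ext i k
  simp [coordMatrix, frameChange, mul_apply]

section Curvature

variable (g : HermitianMetric m M) (p : M) (v : Tan m M p)

lemma sum_comm_pairs {α β σ τ R : Type*} [Fintype α] [Fintype β] [Fintype σ] [Fintype τ]
    [AddCommMonoid R] (F : α → β → σ → τ → R) :
    ∑ i, ∑ j, ∑ k, ∑ l, F i j k l = ∑ k, ∑ l, ∑ i, ∑ j, F i j k l := by
  simpa only [Fintype.sum_prod_type] using
    Finset.sum_comm (s := Finset.univ (α := α × β)) (t := Finset.univ (α := σ × τ))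
      (f := fun x y => F x.1 x.2 y.1 y.2)

lemma sum_chernComp {e : OpenPartialHomeomorph M (Cn m)} {z : Cn m} {k l : Fin m}
    (hg : ContDiffAt ℝ 2 (fun w => coeff g e w k l) z) (v : Cn m) :
    ∑ i, ∑ j, v i * star (v j) * chernComp g e z i j k l = curvMat (coeff g e) z v k l := by
  have hquad : ∑ i, ∑ j, v i * star (v j) * ∑ p, ∑ q, invCoeff g e z p q *
      dz i (fun w => coeff g e w k q) z * dzbar j (fun w => coeff g e w p l) z =
      (linMat (coeff g e) z v * (coeff g e z)⁻¹ * conjMat (coeff g e) z v) k l := by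
    simp only [mul_apply, linMat, conjMat, invCoeff, of_apply, ← sum_mul_dz, ← sum_star_mul_dzbar,
      Finset.mul_sum, Finset.sum_mul]
    rw [sum_comm_pairs]
    refine Finset.sum_congr rfl fun p _ => ?_
    conv_rhs => rw [Finset.sum_comm]
    refine Finset.sum_congr rfl fun q _ => ?_
    rw [Finset.sum_comm]
    exact Finset.sum_congr rfl fun j _ => Finset.sum_congr rfl fun i _ => by ring
  rw [curvMat, Matrix.sub_apply, ← hquad, mixedMat, of_apply, ← sum_mul_dz_dzbar _ hg,
    ← Finset.sum_sub_distrib]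
  refine Finset.sum_congr rfl fun i _ => ?_
  rw [← Finset.sum_sub_distrib]
  exact Finset.sum_congr rfl fun j _ => by rw [chernComp]; ring

lemma contDiffAt_coeff (x : M) {z : Cn m} (hz : z ∈ (chartAt (Cn m) x).target) (k l : Fin m) :
    ContDiffAt ℝ 2 (fun w => coeff g (chartAt (Cn m) x) w k l) z :=
  ((g.smooth _ (chart_mem_atlas (Cn m) x) k l).contDiffAt
    ((chartAt (Cn m) x).open_target.mem_nhds hz)).of_le
      (WithTop.coe_le_coe.2 (le_top : (2 : ℕ∞) ≤ ⊤))

lemma chernMat_eq_rowGram (E : ι → Tan m M p) : chernMat g p v E =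
    rowGram (curvMat (coeff g (chartAt (Cn m) p)) (chartAt (Cn m) p p)
      (chartCoord (chartAt (Cn m) p) p v)) (coordMatrix (chartAt (Cn m) p) p E) := by
  have hz := (chartAt (Cn m) p).map_source (mem_chart_source (Cn m) p)
  have hcomp (u : Tan m M p) (k : Fin m) :
    coordComp (chartAt (Cn m) p) p u k = chartCoord (chartAt (Cn m) p) p u k := rfl
  ext i j
  simp only [chernMat, chern, rowGram, mul_apply, of_apply, conjTranspose_apply, hcomp,
    ← sum_chernComp g (contDiffAt_coeff g p hz _ _), coordMatrix, Finset.sum_mul, Finset.mul_sum]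
  rw [sum_comm_pairs, Finset.sum_comm]
  exact Finset.sum_congr rfl fun l _ => Finset.sum_congr rfl fun k _ =>
    Finset.sum_congr rfl fun i _ => Finset.sum_congr rfl fun j _ => by ring

lemma chernMat_frameChange [Fintype κ] (A : Matrix ι κ ℂ) (E : κ → Tan m M p) :
    chernMat g p v (frameChange A E) = rowGram (chernMat g p v E) A := by
  rw [chernMat_eq_rowGram, chernMat_eq_rowGram, coordMatrix_frameChange, rowGram_mul]

end Curvature

section Smooth

variable [IsManifold 𝓘(ℂ, Cn m) ω M] (x : M) {y : M} (hy : y ∈ (chartAt (Cn m) x).source)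
  {z : Cn m} (hz : z ∈ (chartAt (Cn m) x).target)

include hz in
lemma coordMatrix_coordVec :
    coordMatrix (chartAt (Cn m) x) ((chartAt (Cn m) x).symm z)
      (coordVec (chartAt (Cn m) x) z) = 1 := by
  have : IsManifold 𝓘(ℂ, Cn m) 1 M := IsManifold.of_le (n := ω) le_top
  ext i j
  have hcomp := congr_arg (fun L => (L (stdVec i : Cn m)).ofLp j)
    ((mdifferentiable_chart (I := 𝓘(ℂ, Cn m)) x).comp_symm_deriv hz)
  refine Eq.trans hcomp ?_
  change (stdVec i : Cn m).ofLp j = _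
  simp [one_apply, eq_comm]

include hy in
lemma chartCoord_injective : Function.Injective (chartCoord (chartAt (Cn m) x) y) := by
  have : IsManifold 𝓘(ℂ, Cn m) 1 M := IsManifold.of_le (n := ω) le_top
  exact (mdifferentiable_chart (I := 𝓘(ℂ, Cn m)) x).mfderiv_injective hy

include hy in
lemma chartCoord_surjective : Function.Surjective (chartCoord (chartAt (Cn m) x) y) := by
  have : IsManifold 𝓘(ℂ, Cn m) 1 M := IsManifold.of_le (n := ω) le_top
  exact (mdifferentiable_chart (I := 𝓘(ℂ, Cn m)) x).mfderiv_surjective hy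

include hy in
lemma coordMatrix_injective {E E' : ι → Tan m M y} (hE : coordMatrix (chartAt (Cn m) x) y E =
    coordMatrix (chartAt (Cn m) x) y E') : E = E' :=
  funext fun i => chartCoord_injective x hy (WithLp.ofLp_injective 2 (congr_fun hE i))

include hy in
lemma exists_coordMatrix_eq (A : Matrix ι (Fin m) ℂ) :
    ∃ E : ι → Tan m M y, coordMatrix (chartAt (Cn m) x) y E = A := by
  choose E hE using fun i => chartCoord_surjective x hy (WithLp.toLp 2 (A i))
  exact ⟨E, funext fun i => congrArg WithLp.ofLp (hE i)⟩

include hz in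
lemma gram_symm_eq_rowGram (g : HermitianMetric m M)
    (E : ι → Tan m M ((chartAt (Cn m) x).symm z)) :
    gram g ((chartAt (Cn m) x).symm z) E =
      rowGram (coeff g (chartAt (Cn m) x) z) (coordMatrix (chartAt (Cn m) x) _ E) := by
  have hE : E = frameChange (coordMatrix (chartAt (Cn m) x) _ E) (coordVec (chartAt (Cn m) x) z) :=
    coordMatrix_injective x ((chartAt (Cn m) x).map_target hz) (by
      rw [coordMatrix_frameChange, coordMatrix_coordVec x hz, Matrix.mul_one])
  conv_lhs => rw [hE, gram_frameChange]
  rfl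

include hy in
lemma gram_eq_rowGram (g : HermitianMetric m M) (E : ι → Tan m M y) : gram g y E =
    rowGram (coeff g (chartAt (Cn m) x) (chartAt (Cn m) x y))
      (coordMatrix (chartAt (Cn m) x) y E) := by
  obtain ⟨z, hz, rfl⟩ := (chartAt (Cn m) x).symm_image_target_eq_source.symm ▸ hy
  rw [gram_symm_eq_rowGram x hz, (chartAt (Cn m) x).right_inv hz]

include hz in
lemma posDef_coeff (g : HermitianMetric m M) : (coeff g (chartAt (Cn m) x) z).PosDef := by
  have hcoords : chartCoord (chartAt (Cn m) x) _ ∘ coordVec (chartAt (Cn m) x) z = stdVec :=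
    funext fun i => WithLp.ofLp_injective 2 <| (congr_fun (coordMatrix_coordVec x hz) i).trans <| by
      ext j
      simp [one_apply, eq_comm]
  refine posDef_gram g _ (LinearIndependent.of_comp (chartCoord (chartAt (Cn m) x) _) ?_)
  rw [hcoords]
  exact EuclideanSpace.orthonormal_single.linearIndependent

lemma posSemidef_gram [Finite ι] (g : HermitianMetric m M) (E : ι → Tan m M x) :
    (gram g x E).PosSemidef := by
  have hx := mem_chart_source (Cn m) x
  rw [gram_eq_rowGram x hx]
  exact posSemidef_rowGram (posDef_coeff x ((chartAt (Cn m) x).map_source hx) g).posSemidef _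

include hz in
lemma isMetricAt_coeff (g : HermitianMetric m M) : IsMetricAt (coeff g (chartAt (Cn m) x)) z where
  contDiffAt := contDiffAt_coeff g x hz
  posDef := by
    filter_upwards [(chartAt (Cn m) x).open_target.mem_nhds hz] with w hw
    exact posDef_coeff x hw g

end Smooth

end Charts

section TangentMap

variable {m n : ℕ} {M N : Type*} [TopologicalSpace M] [ChartedSpace (Cn m) M]
  [TopologicalSpace N] [ChartedSpace (Cn n) N]

variable (m n) in
/-- The complex linear tangent map `∂f_x : T'_x M → T'_{f(x)} N` of `f` at `x`. -/
def tangentMapAt (f : M → N) (x : M) : Tan m M x →ₗ[ℂ] Tan n N (f x) :=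
  (mfderiv 𝓘(ℂ, Cn m) 𝓘(ℂ, Cn n) f x).toLinearMap

variable (m n) in
/-- The representation of `f` in the preferred charts at `x` and at `f x`. -/
def localRep (f : M → N) (x : M) : Cn m → Cn n :=
  chartAt (Cn n) (f x) ∘ f ∘ (chartAt (Cn m) x).symm

variable [IsManifold 𝓘(ℂ, Cn m) ω M] [IsManifold 𝓘(ℂ, Cn n) ω N] {f : M → N}
  (hf : ContMDiff 𝓘(ℂ, Cn m) 𝓘(ℂ, Cn n) ω f) (x : M) {ι : Type*}

include hf

section Coordinates

variable {y : M} (hy : y ∈ (chartAt (Cn m) x).source)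
  (hfy : f y ∈ (chartAt (Cn n) (f x)).source)

include hy hfy

lemma analyticAt_localRep : AnalyticAt ℂ (localRep m n f x) (chartAt (Cn m) x y) := by
  have hyt := (chartAt (Cn m) x).map_source hy
  have hsymm : ContMDiffAt 𝓘(ℂ, Cn m) 𝓘(ℂ, Cn m) ω (chartAt (Cn m) x).symm (chartAt (Cn m) x y) :=
    (contMDiffOn_chart_symm (x := x)).contMDiffAt ((chartAt (Cn m) x).open_target.mem_nhds hyt)
  have hchart : ContMDiffAt 𝓘(ℂ, Cn n) 𝓘(ℂ, Cn n) ω (chartAt (Cn n) (f x)) (f y) :=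
    (contMDiffOn_chart (x := f x)).contMDiffAt ((chartAt (Cn n) (f x)).open_source.mem_nhds hfy)
  have hrep : ContMDiffAt 𝓘(ℂ, Cn m) 𝓘(ℂ, Cn n) ω (localRep m n f x) (chartAt (Cn m) x y) := by
    refine ContMDiffAt.comp (g := chartAt (Cn n) (f x)) (chartAt (Cn m) x y) ?_
      (ContMDiffAt.comp (g := f) (chartAt (Cn m) x y) (hf _) hsymm)
    rwa [Function.comp_apply, (chartAt (Cn m) x).left_inv hy]
  exact analyticWithinAt_univ.1
    (contDiffWithinAt_omega_iff_analyticWithinAt.1 (contDiffWithinAt_univ.2 hrep.contDiffAt))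

lemma chartCoord_tangentMapAt (u : Tan m M y) :
    chartCoord (chartAt (Cn n) (f x)) (f y) (tangentMapAt m n f y u) =
      fderiv ℂ (localRep m n f x) (chartAt (Cn m) x y) (chartCoord (chartAt (Cn m) x) y u) := by
  have : IsManifold 𝓘(ℂ, Cn m) 1 M := IsManifold.of_le (n := ω) le_top
  have : IsManifold 𝓘(ℂ, Cn n) 1 N := IsManifold.of_le (n := ω) le_top
  have hleft := mfderiv_comp y
    ((mdifferentiable_chart (I := 𝓘(ℂ, Cn n)) (f x)).mdifferentiableAt hfy)
    (hf.mdifferentiable (by simp) y)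
  have hright := mfderiv_comp y
    (analyticAt_localRep hf x hy hfy).differentiableAt.mdifferentiableAt
    ((mdifferentiable_chart (I := 𝓘(ℂ, Cn m)) x).mdifferentiableAt hy)
  have heq : chartAt (Cn n) (f x) ∘ f =ᶠ[𝓝 y] localRep m n f x ∘ chartAt (Cn m) x := by
    filter_upwards [(chartAt (Cn m) x).open_source.mem_nhds hy] with w hw
    simp only [Function.comp_apply, localRep, (chartAt (Cn m) x).left_inv hw]
  rw [heq.mfderiv_eq, hright, mfderiv_eq_fderiv] at hleft
  exact (congrArg (fun L => L u) hleft).symm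

lemma coordMatrix_tangentMapAt (E : ι → Tan m M y) :
    coordMatrix (chartAt (Cn n) (f x)) (f y) (tangentMapAt m n f y ∘ E) =
      coordMatrix (chartAt (Cn m) x) y E *
        jacobianRow (localRep m n f x) (chartAt (Cn m) x y) := by
  funext i
  exact (congrArg WithLp.ofLp (chartCoord_tangentMapAt hf x hy hfy (E i))).trans
    (vecMul_jacobianRow _ _ _).symm

omit [IsManifold 𝓘(ℂ, Cn m) ω M] [IsManifold 𝓘(ℂ, Cn n) ω N] hf hfy in
lemma localRep_chartAt :
    localRep m n f x (chartAt (Cn m) x y) = chartAt (Cn n) (f x) (f y) := by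
  simp [localRep, (chartAt (Cn m) x).left_inv hy]

lemma gram_tangentMapAt (h : HermitianMetric n N) (E : ι → Tan m M y) :
    gram h (f y) (tangentMapAt m n f y ∘ E) =
      rowGram (coeff h (chartAt (Cn n) (f x)) (localRep m n f x (chartAt (Cn m) x y)))
        (coordMatrix (chartAt (Cn m) x) y E *
          jacobianRow (localRep m n f x) (chartAt (Cn m) x y)) := by
  rw [gram_eq_rowGram (f x) hfy, localRep_chartAt x hy, coordMatrix_tangentMapAt hf x hy hfy]

end Coordinates

lemma chernMat_tangentMapAt (h : HermitianMetric n N) (v : Tan m M x) (E : ι → Tan m M x) :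
    chernMat h (f x) (tangentMapAt m n f x v) (tangentMapAt m n f x ∘ E) =
      rowGram (curvMat (coeff h (chartAt (Cn n) (f x))) (localRep m n f x (chartAt (Cn m) x x))
          (fderiv ℂ (localRep m n f x) (chartAt (Cn m) x x)
            (chartCoord (chartAt (Cn m) x) x v)))
        (coordMatrix (chartAt (Cn m) x) x E *
          jacobianRow (localRep m n f x) (chartAt (Cn m) x x)) := by
  have hx := mem_chart_source (Cn m) x
  have hfx := mem_chart_source (Cn n) (f x)
  rw [chernMat_eq_rowGram, chartCoord_tangentMapAt hf x hx hfx,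
    coordMatrix_tangentMapAt hf x hx hfx, localRep_chartAt x hx]

omit [IsManifold 𝓘(ℂ, Cn m) ω M] [IsManifold 𝓘(ℂ, Cn n) ω N] in
lemma eventually_mem_chart_source : ∀ᶠ z in 𝓝 (chartAt (Cn m) x x),
    z ∈ (chartAt (Cn m) x).target ∧
      f ((chartAt (Cn m) x).symm z) ∈ (chartAt (Cn n) (f x)).source := by
  have hx := (chartAt (Cn m) x).map_source (mem_chart_source (Cn m) x)
  have hcont : ContinuousAt (f ∘ (chartAt (Cn m) x).symm) (chartAt (Cn m) x x) :=
    hf.continuous.continuousAt.comp ((chartAt (Cn m) x).continuousAt_symm hx)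
  refine Filter.Eventually.and ((chartAt (Cn m) x).open_target.mem_nhds hx) (hcont ?_)
  rw [Function.comp_apply, (chartAt (Cn m) x).left_inv (mem_chart_source (Cn m) x)]
  exact (chartAt (Cn n) (f x)).open_source.mem_nhds (mem_chart_source _ _)

variable {g : HermitianMetric m M} {h : HermitianMetric n N}

lemma eventually_of_forall_unitary {P : Matrix ι ι ℂ → Prop} [DecidableEq ι]
    (hP : ∀ (y : M) (E : ι → Tan m M y), gram g y E = 1 →
      P (gram h (f y) (tangentMapAt m n f y ∘ E))) :
    ∀ᶠ z in 𝓝 (chartAt (Cn m) x x), ∀ A : Matrix ι (Fin m) ℂ,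
      rowGram (coeff g (chartAt (Cn m) x) z) A = 1 →
      P (rowGram (coeff h (chartAt (Cn n) (f x)) (localRep m n f x z))
        (A * jacobianRow (localRep m n f x) z)) := by
  filter_upwards [eventually_mem_chart_source hf x] with z ⟨hz, hfz⟩ A hA
  have hy := (chartAt (Cn m) x).map_target hz
  obtain ⟨E, rfl⟩ := exists_coordMatrix_eq x hy A
  have hP' := hP _ E ((gram_symm_eq_rowGram x hz g E).trans hA)
  rwa [gram_tangentMapAt hf x hy hfz, (chartAt (Cn m) x).right_inv hz] at hP'

section Bochner

variable {x} [Fintype ι] [DecidableEq ι] {E : ι → Tan m M x} (hE : gram g x E = 1)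
  (v : Tan m M x)

include hE

lemma re_trace_chernMat_le_of_trace_max
    (hmax : ∀ (y : M) (E' : ι → Tan m M y), gram g y E' = 1 →
      (gram h (f y) (tangentMapAt m n f y ∘ E')).trace.re ≤
        (gram h (f x) (tangentMapAt m n f x ∘ E)).trace.re) :
    (chernMat g x v E * gram h (f x) (tangentMapAt m n f x ∘ E)).trace.re ≤
      (chernMat h (f x) (tangentMapAt m n f x v) (tangentMapAt m n f x ∘ E)).trace.re := by
  have hx := mem_chart_source (Cn m) x
  have hfx := mem_chart_source (Cn n) (f x)
  have hη := isMetricAt_coeff (f x) ((chartAt (Cn n) (f x)).map_source hfx) h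
  rw [← localRep_chartAt x hx] at hη
  rw [gram_tangentMapAt hf x hx hfx] at hmax ⊢
  rw [chernMat_tangentMapAt hf, chernMat_eq_rowGram]
  refine re_trace_curvMat_le_of_trace_max (isMetricAt_coeff x ((chartAt (Cn m) x).map_source hx) g)
    hη (analyticAt_localRep hf x hx hfx) ((gram_eq_rowGram x hx g E).symm.trans hE) _
    (eventually_of_forall_unitary hf x (P := fun H => H.trace.re ≤ _) hmax)

lemma re_trace_chernMat_le_of_det_max
    (hH : (gram h (f x) (tangentMapAt m n f x ∘ E)).PosDef)
    (hmax : ∀ (y : M) (E' : ι → Tan m M y), gram g y E' = 1 →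
      (gram h (f y) (tangentMapAt m n f y ∘ E')).det.re ≤
        (gram h (f x) (tangentMapAt m n f x ∘ E)).det.re) :
    (chernMat g x v E).trace.re ≤ ((gram h (f x) (tangentMapAt m n f x ∘ E))⁻¹ *
      chernMat h (f x) (tangentMapAt m n f x v) (tangentMapAt m n f x ∘ E)).trace.re := by
  have hx := mem_chart_source (Cn m) x
  have hfx := mem_chart_source (Cn n) (f x)
  have hη := isMetricAt_coeff (f x) ((chartAt (Cn n) (f x)).map_source hfx) h
  rw [← localRep_chartAt x hx] at hη
  rw [gram_tangentMapAt hf x hx hfx] at hmax hH ⊢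
  rw [chernMat_tangentMapAt hf, chernMat_eq_rowGram]
  refine re_trace_curvMat_le_of_det_max (isMetricAt_coeff x ((chartAt (Cn m) x).map_source hx) g)
    hη (analyticAt_localRep hf x hx hfx) ((gram_eq_rowGram x hx g E).symm.trans hE) _ hH
    (eventually_of_forall_unitary hf x (P := fun H => H.det.re ≤ _) hmax)

end Bochner

end TangentMap

/-! ### Maxima over unitary frames -/

section Compactness

variable {ι κ : Type*} [Fintype κ]

lemma sq_norm_apply_le_of_rowGram_eq_one [Finite ι] [DecidableEq ι] [DecidableEq κ]
    {g : Matrix κ κ ℂ} (hg : g.PosDef) {A : Matrix ι κ ℂ} (hA : rowGram g A = 1) (i : ι) (k : κ) :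
    ‖A i k‖ ^ 2 ≤ (g⁻¹ k k).re := by
  cases nonempty_fintype ι
  have hdet : IsUnit g.det := hg.det_pos.ne'.isUnit
  have hproj : Aᴴ * A * g * (Aᴴ * A) = Aᴴ * A := by
    calc Aᴴ * A * g * (Aᴴ * A) = Aᴴ * rowGram g A * A := by simp only [rowGram, Matrix.mul_assoc]
      _ = Aᴴ * A := by rw [hA, Matrix.mul_one]
  have hdiff : rowGram g⁻¹ (1 - Aᴴ * A * g) = g⁻¹ - Aᴴ * A := by
    have hstar : (1 - Aᴴ * A * g)ᴴ = 1 - g * (Aᴴ * A) := by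
      simp [conjTranspose_mul, hg.1.eq]
    rw [rowGram, hstar, Matrix.sub_mul, Matrix.one_mul, mul_nonsing_inv_cancel_right _ _ hdet,
      Matrix.mul_sub, Matrix.mul_one, Matrix.sub_mul, nonsing_inv_mul_cancel_left _ _ hdet,
      ← Matrix.mul_assoc, hproj]
    abel
  have hdiag := (posSemidef_rowGram hg.inv.posSemidef (1 - Aᴴ * A * g)).diag_nonneg (i := k)
  rw [hdiff, Matrix.sub_apply, sub_nonneg, mul_apply] at hdiag
  calc ‖A i k‖ ^ 2 ≤ ∑ j, ‖A j k‖ ^ 2 :=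
        Finset.single_le_sum (f := fun j => ‖A j k‖ ^ 2) (fun _ _ => sq_nonneg _)
          (Finset.mem_univ i)
    _ = (∑ j, Aᴴ k j * A j k).re := by
        simp [← Complex.normSq_eq_norm_sq, Complex.normSq_apply]
    _ ≤ (g⁻¹ k k).re := (Complex.le_def.1 hdiag).1

lemma continuousOn_rowGram {X : Type*} [TopologicalSpace X] {K : Set X} {γ : X → Matrix κ κ ℂ}
    {A : X → Matrix ι κ ℂ} (hγ : ContinuousOn γ K) (hA : ContinuousOn A K) :
    ContinuousOn (fun x => rowGram (γ x) (A x)) K := by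
  have hcont : Continuous fun p : Matrix κ κ ℂ × Matrix ι κ ℂ => rowGram p.1 p.2 :=
    (continuous_snd.matrix_mul continuous_fst).matrix_mul continuous_snd.matrix_conjTranspose
  exact hcont.comp_continuousOn (f := fun x => (γ x, A x)) (hγ.prodMk hA)

lemma isCompact_setOf_rowGram_eq_one [Finite ι] [DecidableEq ι] {X : Type*} [TopologicalSpace X]
    [T2Space X] {K : Set X} (hK : IsCompact K) {γ : X → Matrix κ κ ℂ} (hγ : ContinuousOn γ K)
    (hpos : ∀ z ∈ K, (γ z).PosDef) :
    IsCompact {p : X × Matrix ι κ ℂ | p.1 ∈ K ∧ rowGram (γ p.1) p.2 = 1} := by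
  classical
  have hinv : ContinuousOn (fun z => (γ z)⁻¹) K := fun z hz =>
    have hdet : ContinuousAt Ring.inverse (γ z).det := by
      simpa only [Ring.inverse_eq_inv'] using continuousAt_inv₀ (hpos z hz).det_pos.ne'
    (continuousAt_matrix_inv _ hdet).comp_continuousWithinAt (hγ z hz)
  choose C hC using fun k => hK.exists_bound_of_continuousOn
    (f := fun z => (γ z)⁻¹ k k)
    ((continuous_id.matrix_elem k k).comp_continuousOn hinv)
  have hbox : IsCompact {A : Matrix ι κ ℂ | ∀ i k, A i k ∈ Metric.closedBall 0 (√(C k))} :=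
    isCompact_pi_infinite fun _ => isCompact_pi_infinite fun _ => isCompact_closedBall _ _
  have hcont : ContinuousOn (fun p : X × Matrix ι κ ℂ => rowGram (γ p.1) p.2) (K ×ˢ Set.univ) :=
    continuousOn_rowGram (hγ.comp continuousOn_fst fun p hp => hp.1) continuousOn_snd
  refine (hK.prod hbox).of_isClosed_subset ?_ ?_
  · simpa only [Set.inter_def, Set.mem_prod, Set.mem_univ, and_true, Set.mem_preimage,
      Set.mem_singleton_iff] using hcont.preimage_isClosed_of_isClosed
        (hK.isClosed.prod isClosed_univ) (isClosed_singleton (x := 1))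
  · rintro ⟨z, A⟩ ⟨hz, hA⟩
    refine ⟨hz, fun i k => mem_closedBall_zero_iff.2 (Real.le_sqrt_of_sq_le ?_)⟩
    exact (sq_norm_apply_le_of_rowGram_eq_one (hpos z hz) hA i k).trans
      ((Complex.re_le_norm _).trans (hC k z hz))

end Compactness

section Maximum

variable {m n : ℕ} {M N : Type*} [TopologicalSpace M] [ChartedSpace (Cn m) M]
  [TopologicalSpace N] [ChartedSpace (Cn n) N] {ι : Type*} [DecidableEq ι]

variable (ι) in
/-- The set of Gram matrices for `h` of the images under `∂f` of the unitary families for `g`,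
indexed by `ι`, at the points of `K`. -/
def imageGrams (g : HermitianMetric m M) (h : HermitianMetric n N) (f : M → N) (K : Set M) :
    Set (Matrix ι ι ℂ) :=
  {H | ∃ y ∈ K, ∃ E : ι → Tan m M y,
    gram g y E = 1 ∧ gram h (f y) (tangentMapAt m n f y ∘ E) = H}

lemma continuousOn_coeff (g : HermitianMetric m M) (x : M) :
    ContinuousOn (coeff g (chartAt (Cn m) x)) (chartAt (Cn m) x).target := fun _ hz =>
  (continuousAt_pi.2 fun k => continuousAt_pi.2 fun l =>
    (contDiffAt_coeff g x hz k l).continuousAt).continuousWithinAt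

lemma continuousAt_jacobianRow {F : Cn m → Cn n} {z : Cn m} (hF : AnalyticAt ℂ F z) :
    ContinuousAt (jacobianRow F) z :=
  continuousAt_pi.2 fun _ => continuousAt_pi.2 fun l =>
    (EuclideanSpace.proj l : Cn n →L[ℂ] ℂ).continuous.continuousAt.comp
      (hF.fderiv.continuousAt.clm_apply continuousAt_const)

variable [IsManifold 𝓘(ℂ, Cn m) ω M] [IsManifold 𝓘(ℂ, Cn n) ω N] {f : M → N}
  (hf : ContMDiff 𝓘(ℂ, Cn m) 𝓘(ℂ, Cn n) ω f) (g : HermitianMetric m M) (h : HermitianMetric n N)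

include hf

lemma imageGrams_eq_image (x : M) {B : Set (Cn m)}
    (hB : ∀ z ∈ B, z ∈ (chartAt (Cn m) x).target ∧
      f ((chartAt (Cn m) x).symm z) ∈ (chartAt (Cn n) (f x)).source) :
    imageGrams ι g h f ((chartAt (Cn m) x).source ∩ chartAt (Cn m) x ⁻¹' B) =
      (fun p : Cn m × Matrix ι (Fin m) ℂ =>
        rowGram (coeff h (chartAt (Cn n) (f x)) (localRep m n f x p.1))
          (p.2 * jacobianRow (localRep m n f x) p.1)) ''
      {p | p.1 ∈ B ∧ rowGram (coeff g (chartAt (Cn m) x) p.1) p.2 = 1} := by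
  ext H
  constructor
  · rintro ⟨y, ⟨hy, hyB⟩, E, hE, rfl⟩
    have hfy := (hB _ hyB).2
    rw [(chartAt (Cn m) x).left_inv hy] at hfy
    exact ⟨(chartAt (Cn m) x y, coordMatrix _ y E), ⟨hyB, (gram_eq_rowGram x hy g E).symm.trans hE⟩,
      (gram_tangentMapAt hf x hy hfy h E).symm⟩
  · rintro ⟨⟨z, A⟩, ⟨hzB, hA⟩, rfl⟩
    obtain ⟨hz, hfz⟩ := hB z hzB
    have hy := (chartAt (Cn m) x).map_target hz
    have hyz := (chartAt (Cn m) x).right_inv hz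
    obtain ⟨E, rfl⟩ := exists_coordMatrix_eq x hy A
    refine ⟨_, ⟨hy, by rwa [Set.mem_preimage, hyz]⟩, E,
      (gram_symm_eq_rowGram x hz g E).trans hA, ?_⟩
    rw [gram_tangentMapAt hf x hy hfz, hyz]

lemma exists_isCompact_imageGrams [Finite ι] (x : M) :
    ∃ K ∈ 𝓝 x, IsCompact (imageGrams ι g h f K) := by
  have hx := mem_chart_source (Cn m) x
  obtain ⟨r, hr, hball⟩ :=
    Metric.nhds_basis_closedBall.mem_iff.1 (eventually_mem_chart_source (m := m) (n := n) hf x)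
  set B := Metric.closedBall (chartAt (Cn m) x x) r
  have hK : (chartAt (Cn m) x).source ∩ chartAt (Cn m) x ⁻¹' B ∈ 𝓝 x :=
    inter_mem ((chartAt (Cn m) x).open_source.mem_nhds hx)
      (((chartAt (Cn m) x).continuousAt hx).preimage_mem_nhds (Metric.closedBall_mem_nhds _ hr))
  refine ⟨_, hK, ?_⟩
  rw [imageGrams_eq_image hf g h x fun z hz => hball hz]
  have hF (z : Cn m) (hz : z ∈ B) : AnalyticAt ℂ (localRep m n f x) z := by
    have han := analyticAt_localRep hf x ((chartAt (Cn m) x).map_target (hball hz).1) (hball hz).2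
    rwa [(chartAt (Cn m) x).right_inv (hball hz).1] at han
  have hη : ContinuousOn (fun z => coeff h (chartAt (Cn n) (f x)) (localRep m n f x z)) B :=
    (continuousOn_coeff h (f x)).comp (fun z hz => (hF z hz).continuousAt.continuousWithinAt)
      fun z hz => (chartAt (Cn n) (f x)).map_source (hball hz).2
  have hJ : ContinuousOn (jacobianRow (localRep m n f x)) B := fun z hz =>
    (continuousAt_jacobianRow (hF z hz)).continuousWithinAt
  refine (isCompact_setOf_rowGram_eq_one (isCompact_closedBall _ r)
    ((continuousOn_coeff g x).mono fun z hz => (hball hz).1)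
    fun z hz => posDef_coeff x (hball hz).1 g).image_of_continuousOn ?_
  have hfst : Set.MapsTo Prod.fst {p : Cn m × Matrix ι (Fin m) ℂ | p.1 ∈ B ∧
      rowGram (coeff g (chartAt (Cn m) x) p.1) p.2 = 1} B := fun p hp => hp.1
  exact continuousOn_rowGram (hη.comp continuousOn_fst hfst)
    ((continuous_fst.matrix_mul continuous_snd).comp_continuousOn
      (continuousOn_snd.prodMk (hJ.comp continuousOn_fst hfst)))

theorem exists_forall_imageGram_le [CompactSpace M] [Finite ι] {Φ : Matrix ι ι ℂ → ℝ}
    (hΦ : Continuous Φ) {x₀ : M} {E₀ : ι → Tan m M x₀} (hE₀ : gram g x₀ E₀ = 1) :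
    ∃ (x : M) (E : ι → Tan m M x), gram g x E = 1 ∧
      ∀ (y : M) (E' : ι → Tan m M y), gram g y E' = 1 →
        Φ (gram h (f y) (tangentMapAt m n f y ∘ E')) ≤
          Φ (gram h (f x) (tangentMapAt m n f x ∘ E)) := by
  choose K hK hcompact using exists_isCompact_imageGrams (ι := ι) hf g h
  obtain ⟨t, ht⟩ := CompactSpace.elim_nhds_subcover K hK
  have himage : imageGrams ι g h f Set.univ = ⋃ x ∈ t, imageGrams ι g h f (K x) := by
    rw [← Set.top_eq_univ, ← ht]
    ext H
    simp only [imageGrams, Set.mem_iUnion, Set.mem_ofPred_eq, exists_prop]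
    exact ⟨fun ⟨y, ⟨x, hx, hy⟩, hH⟩ => ⟨x, hx, y, hy, hH⟩,
      fun ⟨x, hx, y, hy, hH⟩ => ⟨y, ⟨x, hx, hy⟩, hH⟩⟩
  have huniv : IsCompact (imageGrams ι g h f Set.univ) :=
    himage ▸ t.isCompact_biUnion fun x _ => hcompact x
  obtain ⟨_, ⟨x, -, E, hE, rfl⟩, hmax⟩ :=
    huniv.exists_isMaxOn ⟨_, x₀, trivial, E₀, hE₀, rfl⟩ hΦ.continuousOn
  exact ⟨x, E, hE, fun y E' hE' => hmax ⟨y, trivial, E', hE', rfl⟩⟩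

end Maximum

/-! ### Unitary frames and sums of curvatures -/

section UnitaryMatrices

variable {ι κ : Type*} [Fintype ι]

lemma rowGram_mul_conjTranspose (S : Matrix ι ι ℂ) (A : Matrix κ ι ℂ) :
    rowGram (S * Sᴴ) A = A * S * (A * S)ᴴ := by
  simp only [rowGram, conjTranspose_mul, Matrix.mul_assoc]

lemma orthonormal_row_iff [DecidableEq κ] (A : Matrix κ ι ℂ) :
    Orthonormal ℂ (fun i => WithLp.toLp 2 (A i)) ↔ A * Aᴴ = 1 := by
  rw [orthonormal_iff_ite, ← Matrix.ext_iff, forall_comm]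
  refine forall₂_congr fun i j => ?_
  simp only [EuclideanSpace.inner_toLp_toLp, mul_apply_eq_vecMul, one_apply, eq_comm (a := j)]
  rfl

lemma exists_unitary_extension [Finite κ] [DecidableEq κ] [DecidableEq ι] {B : Matrix κ ι ℂ}
    (hB : B * Bᴴ = 1) :
    ∃ U : Matrix ι ι ℂ, U * Uᴴ = 1 ∧ ∃ σ : κ → ι, Function.Injective σ ∧ ∀ i, U (σ i) = B i := by
  cases nonempty_fintype κ
  have hrow := (orthonormal_row_iff B).2 hB
  have hcard : Fintype.card κ ≤ Fintype.card ι := by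
    simpa using hrow.linearIndependent.fintype_card_le_finrank
  obtain ⟨σ⟩ := Function.Embedding.nonempty_of_card_le hcard
  let v : ι → EuclideanSpace ℂ ι := Function.extend σ (fun i => WithLp.toLp 2 (B i)) 0
  have hv : Orthonormal ℂ ((Set.range σ).domRestrict v) := by
    convert hrow.comp (Equiv.ofInjective σ σ.injective).symm (Equiv.injective _) using 1
    ext1 ⟨_, i, rfl⟩
    simp [v, Set.domRestrict_apply, σ.injective.extend_apply]
  obtain ⟨b, hb⟩ := hv.exists_orthonormalBasis_extension_of_card_eq (by simp)
  refine ⟨of fun i => (b i).ofLp, (orthonormal_row_iff _).1 b.orthonormal, σ, σ.injective,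
    fun i => ?_⟩
  refine congrArg WithLp.ofLp ((hb (σ i) ⟨i, rfl⟩).trans ?_)
  exact σ.injective.extend_apply _ _ i

lemma exists_unitary_diagonalization [DecidableEq ι] {A : Matrix ι ι ℂ} (hA : A.PosSemidef) :
    ∃ (U : Matrix ι ι ℂ) (d : ι → ℝ), U * Uᴴ = 1 ∧ (∀ i, 0 ≤ d i) ∧
      rowGram A U = diagonal fun i => (d i : ℂ) := by
  refine ⟨star (hA.1.eigenvectorUnitary : Matrix ι ι ℂ), hA.1.eigenvalues, ?_,
    hA.eigenvalues_nonneg, ?_⟩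
  · rw [← star_eq_conjTranspose, star_star, Unitary.coe_star_mul_self]
  · have hdiag := hA.1.conjStarAlgAut_star_eigenvectorUnitary
    rw [Unitary.conjStarAlgAut_star_apply] at hdiag
    rw [rowGram, ← star_eq_conjTranspose, star_star, hdiag]
    rfl

end UnitaryMatrices

section UnitaryFrames

variable {m : ℕ} {M : Type*} [TopologicalSpace M] [ChartedSpace (Cn m) M]
  (g : HermitianMetric m M) {p : M} {ι κ : Type*}

instance : FiniteDimensional ℂ (Tan m M p) :=
  inferInstanceAs (FiniteDimensional ℂ (Cn m))

lemma finrank_tan : Module.finrank ℂ (Tan m M p) = m :=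
  finrank_euclideanSpace_fin (𝕜 := ℂ) (n := m)

lemma span_frameChange {V : Type*} [AddCommGroup V] [Module ℂ V] [Fintype ι] [DecidableEq ι]
    {S : Matrix ι ι ℂ} (hS : IsUnit S.det) (E : ι → V) :
    Submodule.span ℂ (Set.range (frameChange S E)) = Submodule.span ℂ (Set.range E) := by
  refine le_antisymm (Submodule.span_le.2 ?_) (Submodule.span_le.2 ?_)
  · rintro _ ⟨i, rfl⟩
    exact frameChange_mem_span S E i
  · rintro _ ⟨i, rfl⟩
    have hE : frameChange S⁻¹ (frameChange S E) = E := by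
      rw [← frameChange_mul, nonsing_inv_mul S hS, frameChange_one]
    exact congr_fun hE i ▸ frameChange_mem_span _ _ i

lemma exists_gram_frameChange_eq_one [Fintype ι] [DecidableEq ι] {E : ι → Tan m M p}
    (hE : LinearIndependent ℂ E) :
    ∃ S : Matrix ι ι ℂ, IsUnit S.det ∧ gram g p (frameChange S E) = 1 := by
  obtain ⟨S, hS, hSS⟩ := exists_eq_mul_conjTranspose (posDef_gram g p hE)
  refine ⟨S⁻¹, S.isUnit_nonsing_inv_det hS, ?_⟩
  rw [gram_frameChange, ← rowGram_inv_mul hS (g := gram g p E) (A := 1) (by simpa [rowGram]),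
    Matrix.mul_one]

lemma exists_linearIndependent_extension {v : Tan m M p} (hv : v ≠ 0) {ℓ : ℕ} (hℓ : 1 ≤ ℓ)
    (hℓm : ℓ ≤ m) : ∃ E : Fin ℓ → Tan m M p, LinearIndependent ℂ E ∧ v ∈ Set.range E := by
  induction ℓ, hℓ using Nat.le_induction with
  | base => exact ⟨fun _ => v, LinearIndependent.of_subsingleton 0 hv, 0, rfl⟩
  | succ k _ ih =>
    obtain ⟨E, hE, i, hi⟩ := ih (by omega)
    obtain ⟨u, hu⟩ := exists_linearIndependent_snoc_of_lt_finrank hE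
      (by rw [finrank_tan]; omega)
    exact ⟨_, hu, i.castSucc, by rw [Fin.snoc_castSucc, hi]⟩

variable {g}

lemma linearIndependent_of_posDef_gram [Finite ι] {E : ι → Tan m M p}
    (hE : (gram g p E).PosDef) : LinearIndependent ℂ E := by
  cases nonempty_fintype ι
  refine Fintype.linearIndependent_iff.2 fun c hc => congr_fun ?_
  refine star_eq_zero.1 (by_contra fun hne => (hE.dotProduct_mulVec_pos hne).ne' ?_)
  have hvec : c ᵥ* gram g p E = 0 := by
    ext j
    have hform : g.toForm p (∑ i, c i • E i) (E j) = 0 := by simp [hc]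
    rw [map_sum, LinearMap.sum_apply] at hform
    exact (Finset.sum_congr rfl fun i _ => by simp [gram]).trans hform
  rw [star_star, dotProduct_mulVec, hvec, zero_dotProduct]

lemma linearIndependent_of_gram_eq_one [Finite ι] [DecidableEq ι] {E : ι → Tan m M p}
    (hE : gram g p E = 1) : LinearIndependent ℂ E :=
  linearIndependent_of_posDef_gram (hE ▸ PosDef.one)

lemma isUnitaryBasis_span {ℓ : ℕ} {E : Fin ℓ → Tan m M p} (hE : gram g p E = 1) :
    IsUnitaryBasis g p (Submodule.span ℂ (Set.range E)) E :=
  ⟨(isUnitary_iff g p).2 hE, rfl⟩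

lemma finrank_span_of_gram_eq_one {ℓ : ℕ} {E : Fin ℓ → Tan m M p} (hE : gram g p E = 1) :
    Module.finrank ℂ (Submodule.span ℂ (Set.range E)) = ℓ := by
  rw [finrank_span_eq_card (linearIndependent_of_gram_eq_one hE), Fintype.card_fin]

lemma exists_unitary_frame_extension [IsManifold 𝓘(ℂ, Cn m) ω M] [Finite κ] [DecidableEq κ]
    {w : κ → Tan m M p} (hw : gram g p w = 1) : ∃ e : Fin m → Tan m M p,
      gram g p e = 1 ∧ ∃ σ : κ → Fin m, Function.Injective σ ∧ ∀ i, w i = e (σ i) := by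
  have hp := mem_chart_source (Cn m) p
  obtain ⟨S, hS, hγ⟩ := exists_eq_mul_conjTranspose (posDef_coeff p
    ((chartAt (Cn m) p).map_source hp) g)
  rw [gram_eq_rowGram p hp, hγ, rowGram_mul_conjTranspose] at hw
  obtain ⟨U, hU, σ, hσ, hUσ⟩ := exists_unitary_extension hw
  obtain ⟨e, he⟩ := exists_coordMatrix_eq p hp (U * S⁻¹)
  refine ⟨e, ?_, σ, hσ, congr_fun (coordMatrix_injective p hp (E' := e ∘ σ) ?_)⟩
  · rw [gram_eq_rowGram p hp, hγ, rowGram_mul_conjTranspose, he,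
      Matrix.nonsing_inv_mul_cancel_right S U hS, hU]
  · have hUS : (U.submatrix σ id : Matrix κ (Fin m) ℂ) = coordMatrix (chartAt (Cn m) p) p w * S :=
      funext hUσ
    rw [← Matrix.mul_nonsing_inv_cancel_right S (coordMatrix _ p w) hS, ← hUS]
    exact (congrArg (fun A : Matrix (Fin m) (Fin m) ℂ => A.submatrix σ id) he).symm

end UnitaryFrames

section CurvatureSums

variable {m : ℕ} {M : Type*} [TopologicalSpace M] [ChartedSpace (Cn m) M]
  (g : HermitianMetric m M) (p : M) {ι : Type*}

lemma ric1_eq_re_trace {ℓ : ℕ} (E : Fin ℓ → Tan m M p) (v : Tan m M p) :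
    ric1 g p E v = (chernMat g p v E).trace.re :=
  rfl

lemma scal_eq_sum_ric1 {ℓ : ℕ} (E : Fin ℓ → Tan m M p) :
    scal g p E = ∑ i, ric1 g p E (E i) := by
  simp only [scal, ric1, Complex.re_sum]

lemma sum_mul_ric2 {ℓ : ℕ} (E : Fin ℓ → Tan m M p) (d : Fin ℓ → ℝ) :
    ∑ i, d i * ric2 g p E (E i) =
      ∑ j, (chernMat g p (E j) E * diagonal fun i => (d i : ℂ)).trace.re := by
  simp only [ric2, trace, diag_apply, mul_diagonal, Complex.re_sum, Finset.mul_sum, chernMat,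
    of_apply, Complex.re_mul_ofReal]
  rw [Finset.sum_comm]
  exact Finset.sum_congr rfl fun j _ => Finset.sum_congr rfl fun i _ => mul_comm _ _

lemma chern_smul (c d : ℂ) (v w : Tan m M p) :
    chern g p (c • v) (c • v) (d • w) (d • w) =
      (Complex.normSq c * Complex.normSq d : ℝ) * chern g p v v w w := by
  have hcomp (c : ℂ) (u : Tan m M p) (k : Fin m) :
      coordComp (chartAt (Cn m) p) p (c • u) k = c * coordComp (chartAt (Cn m) p) p u k :=
    congrArg (fun z : Cn m => z k) (map_smul (chartCoord (chartAt (Cn m) p) p) c u)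
  simp only [chern, hcomp, star_mul', Finset.mul_sum, Complex.star_def]
  push_cast
  rw [← Complex.mul_conj, ← Complex.mul_conj]
  exact Finset.sum_congr rfl fun _ _ => Finset.sum_congr rfl fun _ _ =>
    Finset.sum_congr rfl fun _ _ => Finset.sum_congr rfl fun _ _ => by ring

variable {g p}

lemma re_trace_gram_pos [Fintype ι] {w : ι → Tan m M p} {i : ι} (hi : w i ≠ 0) :
    0 < (gram g p w).trace.re := by
  have hform (j : ι) : 0 ≤ (g.toForm p (w j) (w j)).re := by
    by_cases hj : w j = 0
    · simp [hj]
    · exact (g.pos p _ hj).le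
  rw [trace, Complex.re_sum]
  exact Finset.sum_pos' (fun j _ => hform j) ⟨i, Finset.mem_univ i, g.pos p _ hi⟩

section FullFrames

variable [IsManifold 𝓘(ℂ, Cn m) ω M] {E : Fin m → Tan m M p} (hE : gram g p E = 1)

include hE

lemma sum_invCoeff_mul (F : Fin m → Fin m → ℂ) :
    ∑ i, ∑ j, invCoeff g (chartAt (Cn m) p) (chartAt (Cn m) p p) i j * F i j =
      ∑ a, ∑ i, ∑ j, coordComp (chartAt (Cn m) p) p (E a) i *
        star (coordComp (chartAt (Cn m) p) p (E a) j) * F i j := by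
  set A := coordMatrix (chartAt (Cn m) p) p E
  have hA : Aᴴ * (A * coeff g (chartAt (Cn m) p) (chartAt (Cn m) p p)) = 1 :=
    mul_eq_one_comm.1 ((gram_eq_rowGram p (mem_chart_source (Cn m) p) g E).symm.trans hE)
  have hinv : (coeff g (chartAt (Cn m) p) (chartAt (Cn m) p p))⁻¹ = Aᴴ * A :=
    inv_eq_left_inv (by rw [Matrix.mul_assoc, hA])
  simp only [invCoeff, hinv, mul_apply, conjTranspose_apply, Finset.sum_mul]
  rw [Finset.sum_comm_cycle]
  exact Finset.sum_congr rfl fun a _ => Finset.sum_congr rfl fun i _ =>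
    Finset.sum_congr rfl fun j _ => congrArg (· * F i j) (mul_comm _ _)

lemma ricci_eq_ric1 (v : Tan m M p) : ricci g p v = ric1 g p E v := by
  simp only [ricci, ric1, chern, sum_invCoeff_mul hE, Finset.sum_mul]
  rw [Finset.sum_comm_cycle]
  refine congrArg Complex.re (Finset.sum_congr rfl fun a _ => Finset.sum_congr rfl fun i _ =>
    Finset.sum_congr rfl fun j _ => Finset.sum_congr rfl fun k _ =>
      Finset.sum_congr rfl fun l _ => ?_)
  ring

lemma scalar_eq_scal : scalar g p = scal g p E := by
  rw [scal_eq_sum_ric1]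
  simp only [← ricci_eq_ric1 hE, scalar, ricci, mul_assoc, ← Finset.mul_sum, ← Complex.re_sum]
  rw [sum_invCoeff_mul hE]
  congr 1
  exact Finset.sum_congr rfl fun _ _ => Finset.sum_congr rfl fun _ _ =>
    Finset.sum_congr rfl fun _ _ => by ring

end FullFrames

section Diagonal

variable {w : ι → Tan m M p} {d : ι → ℝ}

lemma exists_unitary_frame_eq_sqrt_smul [IsManifold 𝓘(ℂ, Cn m) ω M] [Finite ι] [DecidableEq ι]
    (hw : gram g p w = diagonal fun i => (d i : ℂ)) (hd : ∀ i, 0 < d i) :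
    ∃ e : Fin m → Tan m M p, gram g p e = 1 ∧ ∃ σ : ι → Fin m, Function.Injective σ ∧
      ∀ i, w i = (√(d i) : ℂ) • e (σ i) := by
  cases nonempty_fintype ι
  have hsqrt (i : ι) : (√(d i) : ℂ) ≠ 0 := Complex.ofReal_ne_zero.2 (Real.sqrt_ne_zero'.2 (hd i))
  let D : Matrix ι ι ℂ := diagonal fun i => (√(d i) : ℂ)⁻¹
  have hgram : gram g p (frameChange D w) = 1 := by
    rw [gram_frameChange, hw, rowGram, diagonal_conjTranspose, diagonal_mul_diagonal,
      diagonal_mul_diagonal, diagonal_eq_one]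
    ext i
    have hsq : (d i : ℂ) = √(d i) * √(d i) := by
      rw [← Complex.ofReal_mul, Real.mul_self_sqrt (hd i).le]
    have hstar : star ((√(d i) : ℂ)⁻¹) = (√(d i) : ℂ)⁻¹ := by simp
    rw [Pi.star_apply, hstar, hsq, Pi.one_apply]
    field_simp [hsqrt i]
  obtain ⟨e, he, σ, hσ, hwe⟩ := exists_unitary_frame_extension hgram
  refine ⟨e, he, σ, hσ, fun i => ?_⟩
  rw [← hwe]
  simp [D, frameChange, diagonal_apply, ite_smul, smul_smul, hsqrt i]

variable [Fintype ι]

lemma sum_chern_sqrt_smul {e : Fin m → Tan m M p} {σ : ι → Fin m} (hσ : Function.Injective σ)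
    (hd : ∀ i, 0 ≤ d i) (hw : ∀ i, w i = (√(d i) : ℂ) • e (σ i)) :
    ∑ i, ∑ j, (chern g p (w i) (w i) (w j) (w j)).re =
      ∑ i, ∑ j, (chern g p (e i) (e i) (e j) (e j)).re * Function.extend σ d 0 i *
        Function.extend σ d 0 j := by
  have hzero (i : Fin m) (hi : i ∉ Set.range σ) : Function.extend σ d 0 i = 0 :=
    Function.extend_apply' _ _ _ hi
  refine Fintype.sum_of_injective σ hσ _ _ (fun i hi => ?_) fun i =>
    Fintype.sum_of_injective σ hσ _ _ (fun j hj => ?_) fun j => ?_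
  · simp [hzero i hi]
  · simp [hzero j hj]
  · rw [hw i, hw j, chern_smul, hσ.extend_apply, hσ.extend_apply, Complex.re_ofReal_mul,
      Complex.normSq_ofReal, Complex.normSq_ofReal, Real.mul_self_sqrt (hd i),
      Real.mul_self_sqrt (hd j)]
    ring

lemma sum_subtype_pos [DecidableEq ι] (hw : gram g p w = diagonal fun i => (d i : ℂ)) {F : ι → ℝ}
    (hF : ∀ i, w i = 0 → F i = 0) : ∑ i : {i // 0 < d i}, F i = ∑ i, F i := by
  refine Fintype.sum_of_injective _ Subtype.val_injective _ _ (fun i hi => hF i ?_) fun _ => rfl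
  by_contra hne
  have hdi : (gram g p w i i).re = d i := by simp [hw]
  exact hi ⟨⟨i, hdi ▸ g.pos p _ hne⟩, rfl⟩

lemma sum_chern_subtype_pos [DecidableEq ι] (hw : gram g p w = diagonal fun i => (d i : ℂ)) :
    ∑ i : {i // 0 < d i}, ∑ j : {i // 0 < d i}, (chern g p (w i) (w i) (w j) (w j)).re =
      ∑ i, ∑ j, (chern g p (w i) (w i) (w j) (w j)).re := by
  have hchern (v : Tan m M p) : chern g p v v 0 0 = 0 ∧ chern g p 0 0 v v = 0 := by
    have hl := chern_smul g p 1 0 v v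
    have hr := chern_smul g p 0 1 v v
    simp only [one_smul, zero_smul, map_zero, mul_zero, zero_mul, Complex.ofReal_zero] at hl hr
    exact ⟨hl, hr⟩
  rw [← sum_subtype_pos hw fun i hi => by simp [hi, hchern]]
  exact Finset.sum_congr rfl fun i _ => sum_subtype_pos hw
    (F := fun j => (chern g p (w i) (w i) (w j) (w j)).re) fun j hj => by simp [hj, hchern]

lemma exists_realBisec_eq [IsManifold 𝓘(ℂ, Cn m) ω M] [DecidableEq ι]
    (hw : gram g p w = diagonal fun i => (d i : ℂ)) (hd : ∀ i, 0 ≤ d i) (hd₀ : ∃ i, 0 < d i) :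
    ∃ (e : Fin m → Tan m M p) (a : Fin m → ℝ), gram g p e = 1 ∧ (∀ i, 0 ≤ a i) ∧
      0 < ∑ i, a i ^ 2 ∧ ∑ i, ∑ j, (chern g p (w i) (w i) (w j) (w j)).re =
        (∑ i, a i ^ 2) * realBisec g p e a := by
  obtain ⟨e, he, σ, hσ, hwe⟩ := exists_unitary_frame_eq_sqrt_smul (g := g)
    (w := fun i : {i // 0 < d i} => w i) (d := fun i => d i) (by
      ext i j
      exact (congr_fun₂ hw i j).trans (by simp [diagonal_apply, Subtype.ext_iff])) fun i => i.2
  let a : Fin m → ℝ := Function.extend σ (fun i : {i // 0 < d i} => d i) 0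
  have ha (i : {i // 0 < d i}) : a (σ i) = d i := hσ.extend_apply _ _ i
  have ha₀ : 0 ≤ a := Function.extend_nonneg (fun i : {i // 0 < d i} => hd i) le_rfl
  obtain ⟨i₀, hi₀⟩ := hd₀
  have hsq : 0 < ∑ i, a i ^ 2 := Finset.sum_pos' (fun _ _ => sq_nonneg _)
    ⟨σ ⟨i₀, hi₀⟩, Finset.mem_univ _, by rw [ha]; exact pow_pos hi₀ 2⟩
  refine ⟨e, a, he, ha₀, hsq, ?_⟩
  rw [realBisec, ← mul_assoc, mul_one_div_cancel hsq.ne', one_mul,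
    ← sum_chern_sqrt_smul hσ (fun i => hd i) hwe, sum_chern_subtype_pos hw]

end Diagonal

end CurvatureSums

/-! ### Sign conditions on the curvature -/

lemma exists_linearIndependent_comp {V W : Type*} [AddCommGroup V] [Module ℂ V] [AddCommGroup W]
    [Module ℂ W] [FiniteDimensional ℂ V] {L : V →ₗ[ℂ] W} {ℓ : ℕ}
    (hℓ : ℓ ≤ Module.finrank ℂ (LinearMap.range L)) :
    ∃ E : Fin ℓ → V, LinearIndependent ℂ (L ∘ E) := by
  let b := Module.finBasis ℂ (LinearMap.range L)
  choose E hE using fun i : Fin ℓ => (b (Fin.castLE hℓ i)).2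
  refine ⟨E, ?_⟩
  rw [show L ∘ E = Submodule.subtype _ ∘ b ∘ Fin.castLE hℓ from funext hE]
  exact (b.linearIndependent.comp _ (Fin.castLE_injective hℓ)).map' _ (Submodule.ker_subtype _)

lemma trace_inv_mul_mul_conjTranspose {ι : Type*} [Fintype ι] [DecidableEq ι] (S C : Matrix ι ι ℂ) :
    ((S * Sᴴ)⁻¹ * C).trace = (rowGram C S⁻¹).trace := by
  rw [Matrix.mul_inv_rev, Matrix.mul_assoc, trace_mul_comm, rowGram, conjTranspose_nonsing_inv]

section Rank

variable {m n : ℕ} {M N : Type*} [TopologicalSpace M] [ChartedSpace (Cn m) M]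
  [IsManifold 𝓘(ℂ, Cn m) ω M] [CompactSpace M] [TopologicalSpace N] [ChartedSpace (Cn n) N]
  [IsManifold 𝓘(ℂ, Cn n) ω N] {f : M → N} (hf : ContMDiff 𝓘(ℂ, Cn m) 𝓘(ℂ, Cn n) ω f) {ℓ : ℕ}
  {x₀ : M}

include hf

section Maximizers

variable (g : HermitianMetric m M) (h : HermitianMetric n N)

lemma exists_unitary_frame_det_max
    (hx₀ : ℓ ≤ Module.finrank ℂ (LinearMap.range (tangentMapAt m n f x₀))) :
    ∃ (x : M) (E : Fin ℓ → Tan m M x), gram g x E = 1 ∧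
      (gram h (f x) (tangentMapAt m n f x ∘ E)).PosDef ∧
      ∀ (y : M) (E' : Fin ℓ → Tan m M y), gram g y E' = 1 →
        (gram h (f y) (tangentMapAt m n f y ∘ E')).det.re ≤
          (gram h (f x) (tangentMapAt m n f x ∘ E)).det.re := by
  obtain ⟨E₀, hE₀⟩ := exists_linearIndependent_comp hx₀
  obtain ⟨S, hS, hgram⟩ := exists_gram_frameChange_eq_one g (hE₀.of_comp (tangentMapAt m n f x₀))
  obtain ⟨x, E, hE, hmax⟩ := exists_forall_imageGram_le hf g h
    (Complex.continuous_re.comp continuous_id.matrix_det) hgram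
  refine ⟨x, E, hE, (posSemidef_gram _ h _).posDef_iff_det_ne_zero.2 fun hdet => ?_, hmax⟩
  have hpos : (rowGram (gram h (f x₀) (tangentMapAt m n f x₀ ∘ E₀)) S).PosDef :=
    (posSemidef_rowGram (posDef_gram h _ hE₀).posSemidef S).posDef_iff_det_ne_zero.2 (by
      rw [rowGram, det_mul, det_mul, det_conjTranspose]
      exact mul_ne_zero (mul_ne_zero hS.ne_zero (posDef_gram h _ hE₀).det_pos.ne')
        (star_ne_zero.2 hS.ne_zero))
  have hle := hmax x₀ _ hgram
  rw [map_comp_frameChange, gram_frameChange] at hle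
  simp only [Function.comp_apply, id, hdet, Complex.zero_re] at hle
  exact hle.not_gt (Complex.pos_iff.1 hpos.det_pos).1

theorem exists_ric1_le
    (hx₀ : ℓ ≤ Module.finrank ℂ (LinearMap.range (tangentMapAt m n f x₀))) :
    ∃ (x : M) (E E' : Fin ℓ → Tan m M x),
      gram g x E = 1 ∧ LinearIndependent ℂ (tangentMapAt m n f x ∘ E) ∧
      gram h (f x) (tangentMapAt m n f x ∘ E') = 1 ∧
      Submodule.span ℂ (Set.range E') = Submodule.span ℂ (Set.range E) ∧
      ∀ v, ric1 g x E v ≤ ric1 h (f x) (tangentMapAt m n f x ∘ E') (tangentMapAt m n f x v) := by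
  obtain ⟨x, E, hE, hH, hmax⟩ := exists_unitary_frame_det_max hf g h hx₀
  obtain ⟨S, hS, hSS⟩ := exists_eq_mul_conjTranspose hH
  refine ⟨x, E, frameChange S⁻¹ E, hE, linearIndependent_of_posDef_gram hH, ?_,
    span_frameChange (S.isUnit_nonsing_inv_det hS) E, fun v => ?_⟩
  · rw [map_comp_frameChange, gram_frameChange, ← Matrix.mul_one S⁻¹]
    exact rowGram_inv_mul hS (by simpa [rowGram] using hSS)
  · rw [ric1_eq_re_trace, ric1_eq_re_trace, map_comp_frameChange, chernMat_frameChange,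
      ← trace_inv_mul_mul_conjTranspose, ← hSS]
    exact re_trace_chernMat_le_of_det_max hf hE v hH hmax

omit [IsManifold 𝓘(ℂ, Cn m) ω M] [CompactSpace M] [IsManifold 𝓘(ℂ, Cn n) ω N] hf in
lemma exists_unitary_frame_map_ne_zero (hℓ : 1 ≤ ℓ) (hℓm : ℓ ≤ m)
    (hx₀ : tangentMapAt m n f x₀ ≠ 0) : ∃ E : Fin ℓ → Tan m M x₀, gram g x₀ E = 1 ∧
      ∃ i, tangentMapAt m n f x₀ (E i) ≠ 0 := by
  obtain ⟨v, hv⟩ := DFunLike.ne_iff.1 hx₀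
  have hv₀ : v ≠ 0 := fun h0 => hv (by rw [h0, map_zero, map_zero])
  obtain ⟨E, hE, hvE⟩ := exists_linearIndependent_extension hv₀ hℓ hℓm
  obtain ⟨S, hS, hgram⟩ := exists_gram_frameChange_eq_one g hE
  refine ⟨_, hgram, not_forall_not.1 fun hker => hv ?_⟩
  have hspan : Submodule.span ℂ (Set.range (frameChange S E)) ≤
      LinearMap.ker (tangentMapAt m n f x₀) :=
    Submodule.span_le.2 (Set.range_subset_iff.2 fun i => not_not.1 (hker i))
  exact hspan (span_frameChange hS E ▸ Submodule.subset_span hvE)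

lemma exists_unitary_frame_trace_max (hℓ : 1 ≤ ℓ) (hℓm : ℓ ≤ m)
    (hx₀ : tangentMapAt m n f x₀ ≠ 0) :
    ∃ (x : M) (E : Fin ℓ → Tan m M x) (d : Fin ℓ → ℝ), gram g x E = 1 ∧
      gram h (f x) (tangentMapAt m n f x ∘ E) = diagonal (fun i => (d i : ℂ)) ∧
      (∀ i, 0 ≤ d i) ∧ (∃ i, 0 < d i) ∧
      ∀ (y : M) (E' : Fin ℓ → Tan m M y), gram g y E' = 1 →
        (gram h (f y) (tangentMapAt m n f y ∘ E')).trace.re ≤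
          (gram h (f x) (tangentMapAt m n f x ∘ E)).trace.re := by
  obtain ⟨E₀, hE₀, i₀, hi₀⟩ := exists_unitary_frame_map_ne_zero g hℓ hℓm hx₀
  obtain ⟨x, E, hE, hmax⟩ := exists_forall_imageGram_le hf g h
    (Complex.continuous_re.comp continuous_id.matrix_trace) hE₀
  obtain ⟨U, d, hU, hd, hdiag⟩ := exists_unitary_diagonalization
    (posSemidef_gram _ h (tangentMapAt m n f x ∘ E))
  have hgram : gram h (f x) (tangentMapAt m n f x ∘ frameChange U E) =
      rowGram (gram h (f x) (tangentMapAt m n f x ∘ E)) U := by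
    rw [map_comp_frameChange, gram_frameChange]
  have htrace : (gram h (f x) (tangentMapAt m n f x ∘ frameChange U E)).trace =
      (gram h (f x) (tangentMapAt m n f x ∘ E)).trace := by
    rw [hgram, rowGram, trace_mul_comm, ← Matrix.mul_assoc, mul_eq_one_comm.1 hU, Matrix.one_mul]
  simp only [Function.comp_apply, id, ← htrace] at hmax
  refine ⟨x, frameChange U E, d, ?_, hgram.trans hdiag, hd, ?_, hmax⟩
  · rw [gram_frameChange, hE, rowGram, Matrix.mul_one, hU]
  · have hsum : 0 < ∑ i, d i := by
      have hle := (re_trace_gram_pos (g := h) (w := tangentMapAt m n f x₀ ∘ E₀) hi₀).trans_le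
        (hmax x₀ _ hE₀)
      rwa [hgram, hdiag, trace_diagonal, ← Complex.ofReal_sum, Complex.ofReal_re] at hle
    by_contra! hd₀
    exact hsum.not_ge (Finset.sum_nonpos fun i _ => hd₀ i)

omit [CompactSpace M] in
variable {g h} in
lemma sum_mul_ric2_le {x : M} {E : Fin ℓ → Tan m M x} {d : Fin ℓ → ℝ} (hE : gram g x E = 1)
    (hgram : gram h (f x) (tangentMapAt m n f x ∘ E) = diagonal fun i => (d i : ℂ))
    (hmax : ∀ (y : M) (E' : Fin ℓ → Tan m M y), gram g y E' = 1 →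
      (gram h (f y) (tangentMapAt m n f y ∘ E')).trace.re ≤
        (gram h (f x) (tangentMapAt m n f x ∘ E)).trace.re) :
    ∑ i, d i * ric2 g x E (E i) ≤ ∑ j, ∑ i, (chern h (f x)
      (tangentMapAt m n f x (E j)) (tangentMapAt m n f x (E j))
      (tangentMapAt m n f x (E i)) (tangentMapAt m n f x (E i))).re := by
  rw [sum_mul_ric2]
  refine Finset.sum_le_sum fun j _ => ?_
  rw [← hgram]
  exact (re_trace_chernMat_le_of_trace_max hf hE (E j) hmax).trans_eq (Complex.re_sum _ _)

end Maximizers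

variable {g : HermitianMetric m M} {h : HermitianMetric n N}

theorem finrank_range_lt (hℓ : 1 ≤ ℓ)
    (H : (ScalSign g ℓ (0 ≤ ·) ∧ Ric1Sign h ℓ (· < 0)) ∨
      (ScalSign g ℓ (0 < ·) ∧ Ric1Sign h ℓ (· ≤ 0)) ∨
      (Ric1Sign g ℓ (0 ≤ ·) ∧ ScalSign h ℓ (· < 0)) ∨
      (Ric1Sign g ℓ (0 < ·) ∧ ScalSign h ℓ (· ≤ 0))) (x₀ : M) :
    Module.finrank ℂ (LinearMap.range (tangentMapAt m n f x₀)) < ℓ := by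
  by_contra! hx₀
  obtain ⟨x, E, E', hE, hli, hE', hspan, hle⟩ := exists_ric1_le hf g h hx₀
  have : Nonempty (Fin ℓ) := ⟨⟨0, hℓ⟩⟩
  have hbasis := isUnitaryBasis_span hE
  have hbasis' := isUnitaryBasis_span hE'
  have hfr := finrank_span_of_gram_eq_one hE
  have hfr' := finrank_span_of_gram_eq_one hE'
  have hmem (i : Fin ℓ) : tangentMapAt m n f x (E i) ∈
      Submodule.span ℂ (Set.range (tangentMapAt m n f x ∘ E')) := by
    rw [Set.range_comp, ← Submodule.map_span, hspan]
    exact Submodule.mem_map_of_mem (Submodule.subset_span ⟨i, rfl⟩)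
  have hmem' (i : Fin ℓ) : E' i ∈ Submodule.span ℂ (Set.range E) :=
    hspan ▸ Submodule.subset_span ⟨i, rfl⟩
  have hne (i : Fin ℓ) : tangentMapAt m n f x (E i) ≠ 0 := hli.ne_zero i
  have hne' : ∀ i, E' i ≠ 0 :=
    ((linearIndependent_of_gram_eq_one hE').of_comp (tangentMapAt m n f x)).ne_zero
  have hscal : scal g x E ≤ ∑ i, ric1 h (f x) (tangentMapAt m n f x ∘ E')
      (tangentMapAt m n f x (E i)) :=
    (scal_eq_sum_ric1 g x E).trans_le (Finset.sum_le_sum fun i _ => hle (E i))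
  have hscal' : ∑ i, ric1 g x E (E' i) ≤ scal h (f x) (tangentMapAt m n f x ∘ E') :=
    (Finset.sum_le_sum fun i _ => hle (E' i)).trans_eq (scal_eq_sum_ric1 h (f x) _).symm
  rcases H with ⟨hg, hh⟩ | ⟨hg, hh⟩ | ⟨hg, hh⟩ | ⟨hg, hh⟩
  · exact ((hg x _ hfr E hbasis).trans hscal).not_gt (Finset.sum_neg
      (fun i _ => hh _ _ hfr' _ hbasis' _ (hmem i) (hne i)) Finset.univ_nonempty)
  · exact ((hg x _ hfr E hbasis).trans_le hscal).not_ge (Finset.sum_nonpos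
      fun i _ => hh _ _ hfr' _ hbasis' _ (hmem i) (hne i))
  · exact ((Finset.sum_nonneg fun i _ => hg x _ hfr E hbasis _ (hmem' i) (hne' i)).trans
      hscal').not_gt (hh _ _ hfr' _ hbasis')
  · exact ((Finset.sum_pos (fun i _ => hg x _ hfr E hbasis _ (hmem' i) (hne' i))
      Finset.univ_nonempty).trans_le hscal').not_ge (hh _ _ hfr' _ hbasis')

theorem tangentMapAt_eq_zero (hℓ : 1 ≤ ℓ) (hℓm : ℓ ≤ m)
    (H : (Ric2Sign g ℓ (0 < ·) ∧ RealBisecSign h (· ≤ 0)) ∨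
      (Ric2Sign g ℓ (0 ≤ ·) ∧ RealBisecSign h (· < 0))) (x₀ : M) :
    tangentMapAt m n f x₀ = 0 := by
  by_contra hx₀
  obtain ⟨x, E, d, hE, hgram, hd, hd₀, hmax⟩ := exists_unitary_frame_trace_max hf g h hℓ hℓm hx₀
  obtain ⟨e, a, he, ha, hsq, hbisec⟩ := exists_realBisec_eq hgram hd hd₀
  have hle := (sum_mul_ric2_le hf hE hgram hmax).trans_eq hbisec
  obtain ⟨i₀, hi₀⟩ := hd₀
  have hne := (linearIndependent_of_gram_eq_one hE).ne_zero
  have hmem (i : Fin ℓ) : E i ∈ Submodule.span ℂ (Set.range E) := Submodule.subset_span ⟨i, rfl⟩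
  have hfr := finrank_span_of_gram_eq_one hE
  rcases H with ⟨hg, hh⟩ | ⟨hg, hh⟩
  · have hric (i : Fin ℓ) : 0 < ric2 g x E (E i) :=
      hg x _ hfr E (isUnitaryBasis_span hE) _ (hmem i) (hne i)
    have hpos : 0 < ∑ i, d i * ric2 g x E (E i) :=
      Finset.sum_pos' (fun i _ => mul_nonneg (hd i) (hric i).le)
        ⟨i₀, Finset.mem_univ _, mul_pos hi₀ (hric i₀)⟩
    exact (hpos.trans_le hle).not_ge
      (mul_nonpos_of_nonneg_of_nonpos hsq.le (hh _ e ((isUnitary_iff h _).2 he) a ha hsq))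
  · have hnonneg : 0 ≤ ∑ i, d i * ric2 g x E (E i) := Finset.sum_nonneg fun i _ =>
      mul_nonneg (hd i) (hg x _ hfr E (isUnitaryBasis_span hE) _ (hmem i) (hne i))
    exact (hnonneg.trans hle).not_gt
      (mul_neg_of_pos_of_neg hsq (hh _ e ((isUnitary_iff h _).2 he) a ha hsq))

end Rank

/-! ### Rank and degeneracy -/

section Constant

variable {m n : ℕ} {M N : Type*} [TopologicalSpace M] [ChartedSpace (Cn m) M]
  [IsManifold 𝓘(ℂ, Cn m) ω M] [TopologicalSpace N] [ChartedSpace (Cn n) N]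
  [IsManifold 𝓘(ℂ, Cn n) ω N] {f : M → N} (hf : ContMDiff 𝓘(ℂ, Cn m) 𝓘(ℂ, Cn n) ω f)
  (h0 : ∀ x, tangentMapAt m n f x = 0)

include hf h0

lemma hasFDerivAt_localRep_zero (x : M) {z : Cn m} (hz : z ∈ (chartAt (Cn m) x).target)
    (hfz : f ((chartAt (Cn m) x).symm z) ∈ (chartAt (Cn n) (f x)).source) :
    HasFDerivAt (𝕜 := ℂ) (localRep m n f x) 0 z := by
  have hy := (chartAt (Cn m) x).map_target hz
  have hdiff := (analyticAt_localRep hf x hy hfz).differentiableAt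
  have hcoord := chartCoord_tangentMapAt hf x hy hfz
  rw [(chartAt (Cn m) x).right_inv hz] at hdiff hcoord
  have hzero : fderiv ℂ (localRep m n f x) z = 0 := by
    ext1 w
    obtain ⟨u, rfl⟩ := chartCoord_surjective x hy w
    rw [← hcoord, h0, LinearMap.zero_apply, map_zero, _root_.zero_apply]
  exact hzero ▸ hdiff.hasFDerivAt

lemma eventually_eq_of_tangentMapAt_eq_zero (x : M) : ∀ᶠ y in 𝓝 x, f y = f x := by
  have hx := mem_chart_source (Cn m) x
  have hfx := mem_chart_source (Cn n) (f x)
  obtain ⟨r, hr, hball⟩ := Metric.eventually_nhds_iff_ball.1 (eventually_mem_chart_source hf x)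
  have hderiv (z) (hz : z ∈ Metric.ball (chartAt (Cn m) x x) r) :=
    hasFDerivAt_localRep_zero hf h0 x (hball z hz).1 (hball z hz).2
  have hconst (z) (hz : z ∈ Metric.ball (chartAt (Cn m) x x) r) :
      localRep m n f x z = localRep m n f x (chartAt (Cn m) x x) :=
    Metric.isOpen_ball.is_const_of_fderiv_eq_zero (𝕜 := ℂ) (convex_ball _ _).isPreconnected
      (fun w hw => (hderiv w hw).differentiableAt.differentiableWithinAt)
      (fun w hw => (hderiv w hw).fderiv) hz (Metric.mem_ball_self hr)
  filter_upwards [(chartAt (Cn m) x).open_source.mem_nhds hx,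
    hf.continuous.continuousAt ((chartAt (Cn n) (f x)).open_source.mem_nhds hfx),
    (chartAt (Cn m) x).continuousAt hx (Metric.ball_mem_nhds _ hr)] with y hy hfy hyr
  refine (chartAt (Cn n) (f x)).injOn hfy hfx ?_
  rw [← localRep_chartAt x hy, ← localRep_chartAt x hx, hconst _ hyr]

lemma exists_eq_const [ConnectedSpace M] : ∃ c : N, ∀ x : M, f x = c := by
  have hloc : IsLocallyConstant f :=
    (IsLocallyConstant.iff_eventually_eq f).2 (eventually_eq_of_tangentMapAt_eq_zero hf h0)
  exact ⟨f (Classical.arbitrary M), fun x => hloc.apply_eq_of_preconnectedSpace x _⟩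

end Constant

lemma mapRank_lt {m n : ℕ} {M N : Type*} [TopologicalSpace M] [ChartedSpace (Cn m) M]
    [TopologicalSpace N] [ChartedSpace (Cn n) N] {f : M → N} {ℓ : ℕ} (hℓ : 1 ≤ ℓ)
    (hr : ∀ x, Module.finrank ℂ (LinearMap.range (tangentMapAt m n f x)) < ℓ) :
    mapRank m n f < (ℓ : ℕ∞) :=
  (iSup_le (a := ((ℓ - 1 : ℕ) : ℕ∞)) fun x => Nat.cast_le.2 (Nat.le_sub_one_of_lt (hr x))).trans_lt
    (Nat.cast_lt.2 (Nat.sub_one_lt_of_lt hℓ))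

section Sign

variable {m : ℕ} {M : Type*} [TopologicalSpace M] [ChartedSpace (Cn m) M]
  [IsManifold 𝓘(ℂ, Cn m) ω M] {g : HermitianMetric m M} {P : ℝ → Prop}

lemma ScalarSign.scalSign (hg : ScalarSign g P) : ScalSign g m P := by
  intro p _ _ E hE
  rw [← scalar_eq_scal ((isUnitary_iff g p).1 hE.1)]
  exact hg p

lemma RicciSign.ric1Sign (hg : RicciSign g P) : Ric1Sign g m P := by
  intro p _ _ E hE v _ hv
  rw [← ricci_eq_ric1 ((isUnitary_iff g p).1 hE.1)]
  exact hg p v hv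

end Sign

section Degenerate

lemma det_restrictScalars_eq_zero {V : Type*} [NormedAddCommGroup V] [NormedSpace ℂ V]
    [FiniteDimensional ℂ V] {A : V →L[ℂ] V}
    (hA : ¬ Function.Surjective A) : (A.restrictScalars ℝ).det = 0 := by
  have := FiniteDimensional.complexToReal V
  by_contra hdet
  exact hA (LinearMap.equivOfDetNeZero (A.restrictScalars ℝ).toLinearMap hdet).surjective

variable {m n d : ℕ} {M N : Type*} [TopologicalSpace M] [ChartedSpace (Cn m) M]
  [IsManifold 𝓘(ℂ, Cn m) ω M] [TopologicalSpace N] [ChartedSpace (Cn n) N]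
  [IsManifold 𝓘(ℂ, Cn n) ω N] {f : M → N}

lemma volume_image_eq_zero_of_mfderiv_not_surjective [CompactSpace M] {F : M → Cn m} {s : Set M}
    (hF : ∀ y ∈ s, MDifferentiableAt 𝓘(ℂ, Cn m) 𝓘(ℂ, Cn m) F y)
    (hsurj : ∀ y ∈ s, ¬ Function.Surjective (mfderiv 𝓘(ℂ, Cn m) 𝓘(ℂ, Cn m) F y)) :
    volume (F '' s) = 0 := by
  have : IsManifold 𝓘(ℂ, Cn m) 1 M := IsManifold.of_le (n := ω) le_top
  obtain ⟨t, ht⟩ := isCompact_univ.elim_nhds_subcover (fun x : M => (chartAt (Cn m) x).source)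
    fun x _ => (chartAt (Cn m) x).open_source.mem_nhds (mem_chart_source _ x)
  refine measure_mono_null (t := ⋃ x ∈ t, (F ∘ (chartAt (Cn m) x).symm) ''
    ((chartAt (Cn m) x).target ∩ (chartAt (Cn m) x).symm ⁻¹' s)) ?_
    ((measure_biUnion_null_iff t.countable_toSet).2 fun x _ => ?_)
  · rintro _ ⟨y, hy, rfl⟩
    obtain ⟨x, hx, hyx⟩ := Set.mem_iUnion₂.1 (ht.2 (Set.mem_univ y))
    have hinv := (chartAt (Cn m) x).left_inv hyx
    exact Set.mem_biUnion hx ⟨chartAt (Cn m) x y, ⟨(chartAt (Cn m) x).map_source hyx,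
      by rwa [Set.mem_preimage, hinv]⟩, congrArg F hinv⟩
  · have hcomp (z) (hz : z ∈ (chartAt (Cn m) x).target ∩ (chartAt (Cn m) x).symm ⁻¹' s) :=
      ((hF _ hz.2).hasMFDerivAt.comp z ((mdifferentiable_chart (I := 𝓘(ℂ, Cn m)) x
        ).mdifferentiableAt_symm hz.1).hasMFDerivAt).hasFDerivAt
    refine addHaar_image_eq_zero_of_det_fderivWithin_eq_zero volume
      (fun z hz => ((hcomp z hz).restrictScalars ℝ).hasFDerivWithinAt) fun z hz =>
        det_restrictScalars_eq_zero fun hz' => hsurj _ hz.2 (Function.Surjective.of_comp hz')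

lemma volume_image_chart_eq_zero [CompactSpace M]
    (hf : ContMDiff 𝓘(ℂ, Cn m) 𝓘(ℂ, Cn n) ω f)
    (hr : ∀ x, Module.finrank ℂ (LinearMap.range (tangentMapAt m n f x)) < m)
    (p : N) (A : Cn n →L[ℂ] Cn m) :
    volume ((A ∘ chartAt (Cn n) p) '' (Set.range f ∩ (chartAt (Cn n) p).source)) = 0 := by
  have : IsManifold 𝓘(ℂ, Cn n) 1 N := IsManifold.of_le (n := ω) le_top
  have hcomp (y) (hy : y ∈ f ⁻¹' (chartAt (Cn n) p).source) :=
    (A.hasFDerivAt.hasMFDerivAt.comp (f y) ((mdifferentiable_chart (I := 𝓘(ℂ, Cn n)) p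
      ).mdifferentiableAt hy).hasMFDerivAt).comp y (hf.mdifferentiable (by simp) y).hasMFDerivAt
  rw [← Set.image_preimage_eq_range_inter, ← Set.image_comp]
  refine volume_image_eq_zero_of_mfderiv_not_surjective
    (fun y hy => (hcomp y hy).mdifferentiableAt) fun y hy hsurj => (hr y).not_ge ?_
  rw [(hcomp y hy).mfderiv] at hsurj
  have hrange : LinearMap.range
      ((A.toLinearMap ∘ₗ chartCoord (chartAt (Cn n) p) (f y)) ∘ₗ tangentMapAt m n f y) = ⊤ :=
    LinearMap.range_eq_top.2 hsurj
  have hle := Submodule.finrank_map_le (A.toLinearMap ∘ₗ chartCoord (chartAt (Cn n) p) (f y))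
    (LinearMap.range (tangentMapAt m n f y))
  rwa [← LinearMap.range_comp, hrange, finrank_top, finrank_euclideanSpace_fin] at hle

lemma exists_volume_image_ne_zero {F : Cn d → Cn n} {L : Cn d →L[ℂ] Cn n} {z : Cn d}
    {U : Set (Cn d)} (hmd : m ≤ d) (hF : HasStrictFDerivAt F L z) (hL : Function.Injective L)
    (hU : U ∈ 𝓝 z) :
    ∃ A : Cn n →L[ℂ] Cn m, volume ((A ∘ F) '' U) ≠ 0 := by
  obtain ⟨ι, hι⟩ : ∃ ι : Cn m →ₗ[ℂ] Cn d, Function.Injective ι :=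
    finrank_le_iff_exists_linearMap.1 (by simpa only [finrank_euclideanSpace_fin] using hmd)
  obtain ⟨A, hA⟩ := LinearMap.exists_leftInverse_of_injective (L.toLinearMap ∘ₗ ι)
    (LinearMap.ker_eq_bot.2 (hL.comp hι))
  have hsurj : Function.Surjective (A.toContinuousLinearMap ∘SL L) :=
    fun w => ⟨ι w, LinearMap.congr_fun hA w⟩
  have hmap : Filter.map (A.toContinuousLinearMap ∘ F) (𝓝 z) = 𝓝 (A.toContinuousLinearMap (F z)) :=
    (A.toContinuousLinearMap.hasStrictFDerivAt.comp z hF).map_nhds_eq_of_surj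
      (LinearMap.range_eq_top.2 hsurj)
  have himg : (A.toContinuousLinearMap ∘ F) '' U ∈ 𝓝 (A.toContinuousLinearMap (F z)) :=
    hmap ▸ image_mem_map hU
  exact ⟨A.toContinuousLinearMap, (Measure.measure_pos_of_mem_nhds volume himg).ne'⟩

lemma ContainsPiece.exists_volume_ne_zero {S : Set N}
    (hS : ContainsPiece (n := n) S d) (hmd : m ≤ d) :
    ∃ (p : N) (A : Cn n →L[ℂ] Cn m),
      volume ((A ∘ chartAt (Cn n) p) '' (S ∩ (chartAt (Cn n) p).source)) ≠ 0 := by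
  obtain ⟨U, φ, hU, ⟨z, hz⟩, hφ, -, hinj, hsub⟩ := hS
  have hφz := hφ.contMDiffAt (hU.mem_nhds hz)
  have hsource := (chartAt (Cn n) (φ z)).open_source.mem_nhds (mem_chart_source _ _)
  have hchart : ContMDiffAt 𝓘(ℂ, Cn n) 𝓘(ℂ, Cn n) ω (chartAt (Cn n) (φ z)) (φ z) :=
    (contMDiffOn_chart (x := φ z)).contMDiffAt hsource
  have hstrict := (hchart.comp z hφz).contDiffAt.hasStrictFDerivAt (by simp)
  have hderiv_inj : Function.Injective (fderiv ℂ (chartAt (Cn n) (φ z) ∘ φ) z) := by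
    have hcomp := mfderiv_comp z (hchart.mdifferentiableAt (by simp))
      (hφz.mdifferentiableAt (by simp))
    rw [mfderiv_eq_fderiv] at hcomp
    rw [hcomp]
    exact (chartCoord_injective (φ z) (mem_chart_source _ _)).comp (hinj z hz)
  obtain ⟨A, hA⟩ := exists_volume_image_ne_zero hmd hstrict hderiv_inj
    (Filter.inter_mem (hU.mem_nhds hz) (hφz.continuousAt hsource))
  refine ⟨φ z, A, fun h0 => hA (measure_mono_null ?_ h0)⟩
  rintro _ ⟨w, hw, rfl⟩
  exact ⟨φ w, ⟨hsub ⟨w, hw.1, rfl⟩, hw.2⟩, rfl⟩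

lemma isDegenerate_of_finrank_range_lt [CompactSpace M] (hm : 1 ≤ m)
    (hf : ContMDiff 𝓘(ℂ, Cn m) 𝓘(ℂ, Cn n) ω f)
    (hr : ∀ x, Module.finrank ℂ (LinearMap.range (tangentMapAt m n f x)) < m) :
    IsDegenerate m n f := by
  have hdim (d : ℕ) (hd : ContainsPiece (n := n) (Set.range f) d) : d < m := by
    by_contra! hmd
    obtain ⟨p, A, hA⟩ := hd.exists_volume_ne_zero hmd
    exact hA (volume_image_chart_eq_zero hf hr p A)
  refine (iSup₂_le (a := (((m - 1 : ℕ) : ℕ∞) : WithBot ℕ∞)) fun d hd => ?_).trans_lt ?_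
  · exact WithBot.coe_le_coe.2 (Nat.cast_le.2 (Nat.le_sub_one_of_lt (hdim d hd)))
  · exact WithBot.coe_lt_coe.2 (Nat.cast_lt.2 (Nat.sub_one_lt_of_lt hm))

end Degenerate

end Herm

end

theorem theorem1p4_general {m n : ℕ} (hm : 1 ≤ m)
    {M : Type*} [TopologicalSpace M] [ChartedSpace (Herm.Cn m) M]
    [IsManifold 𝓘(ℂ, Herm.Cn m) ω M] [CompactSpace M] [ConnectedSpace M]
    {N : Type*} [TopologicalSpace N] [ChartedSpace (Herm.Cn n) N]
    [IsManifold 𝓘(ℂ, Herm.Cn n) ω N]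
    (g : Herm.HermitianMetric m M) (h : Herm.HermitianMetric n N)
    (f : M → N) (hf : ContMDiff 𝓘(ℂ, Herm.Cn m) 𝓘(ℂ, Herm.Cn n) ω f) :
    (((Herm.ScalarSign g (0 ≤ ·) ∧ Herm.Ric1Sign h m (· < 0)) ∨
      (Herm.ScalarSign g (0 < ·) ∧ Herm.Ric1Sign h m (· ≤ 0)) ∨
      (Herm.RicciSign g (0 ≤ ·) ∧ Herm.ScalSign h m (· < 0)) ∨
      (Herm.RicciSign g (0 < ·) ∧ Herm.ScalSign h m (· ≤ 0))) →
        Herm.IsDegenerate m n f) ∧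
    (∀ ℓ : ℕ, 1 ≤ ℓ →
      ((Herm.ScalSign g ℓ (0 ≤ ·) ∧ Herm.Ric1Sign h ℓ (· < 0)) ∨
       (Herm.ScalSign g ℓ (0 < ·) ∧ Herm.Ric1Sign h ℓ (· ≤ 0)) ∨
       (Herm.Ric1Sign g ℓ (0 ≤ ·) ∧ Herm.ScalSign h ℓ (· < 0)) ∨
       (Herm.Ric1Sign g ℓ (0 < ·) ∧ Herm.ScalSign h ℓ (· ≤ 0))) →
        Herm.mapRank m n f < (ℓ : ℕ∞)) ∧
    (∀ ℓ : ℕ, 1 ≤ ℓ → ℓ ≤ m →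
      ((Herm.Ric2Sign g ℓ (0 < ·) ∧ Herm.RealBisecSign h (· ≤ 0)) ∨
       (Herm.Ric2Sign g ℓ (0 ≤ ·) ∧ Herm.RealBisecSign h (· < 0))) →
        ∃ c : N, ∀ x : M, f x = c) := by
  refine ⟨fun H => ?_, fun ℓ hℓ H => ?_, fun ℓ hℓ hℓm H => ?_⟩
  · refine Herm.isDegenerate_of_finrank_range_lt hm hf
      (Herm.finrank_range_lt (g := g) (h := h) hf hm ?_)
    exact H.imp (.imp_left fun hg => hg.scalSign) (.imp (.imp_left fun hg => hg.scalSign)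
      (.imp (.imp_left fun hg => hg.ric1Sign) (.imp_left fun hg => hg.ric1Sign)))
  · exact Herm.mapRank_lt hℓ (Herm.finrank_range_lt hf hℓ H)
  · exact Herm.exists_eq_const hf (Herm.tangentMapAt_eq_zero hf hℓ hℓm H)

theorem theorem1p4 {m n : ℕ} (hm : 1 ≤ m) (hmn : m ≤ n)
    {M : Type*} [TopologicalSpace M] [ChartedSpace (Herm.Cn m) M]
    [IsManifold 𝓘(ℂ, Herm.Cn m) ω M] [T2Space M] [CompactSpace M] [ConnectedSpace M]
    {N : Type*} [TopologicalSpace N] [ChartedSpace (Herm.Cn n) N]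
    [IsManifold 𝓘(ℂ, Herm.Cn n) ω N] [T2Space N] [SecondCountableTopology N]
    (g : Herm.HermitianMetric m M) (h : Herm.HermitianMetric n N)
    (f : M → N) (hf : ContMDiff 𝓘(ℂ, Herm.Cn m) 𝓘(ℂ, Herm.Cn n) ω f) :
    -- (a)
    (((Herm.ScalarSign g (0 ≤ ·) ∧ Herm.Ric1Sign h m (· < 0)) ∨
      (Herm.ScalarSign g (0 < ·) ∧ Herm.Ric1Sign h m (· ≤ 0)) ∨
      (Herm.RicciSign g (0 ≤ ·) ∧ Herm.ScalSign h m (· < 0)) ∨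
      (Herm.RicciSign g (0 < ·) ∧ Herm.ScalSign h m (· ≤ 0))) →
        Herm.IsDegenerate m n f) ∧
    -- (b)
    (∀ ℓ : ℕ, 1 ≤ ℓ → ℓ < m → Herm.IsKahler g →
      ((Herm.ScalSign g ℓ (0 ≤ ·) ∧ Herm.Ric1Sign h ℓ (· < 0)) ∨
       (Herm.ScalSign g ℓ (0 < ·) ∧ Herm.Ric1Sign h ℓ (· ≤ 0)) ∨
       (Herm.Ric1Sign g ℓ (0 ≤ ·) ∧ Herm.ScalSign h ℓ (· < 0)) ∨
       (Herm.Ric1Sign g ℓ (0 < ·) ∧ Herm.ScalSign h ℓ (· ≤ 0))) →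
        Herm.mapRank m n f < (ℓ : ℕ∞)) ∧
    -- (c)
    (∀ ℓ : ℕ, 1 ≤ ℓ → ℓ ≤ m →
      ((Herm.Ric2Sign g ℓ (0 < ·) ∧ Herm.RealBisecSign h (· ≤ 0)) ∨
       (Herm.Ric2Sign g ℓ (0 ≤ ·) ∧ Herm.RealBisecSign h (· < 0))) →
        ∃ c : N, ∀ x : M, f x = c) := by
  obtain ⟨ha, hb, hc⟩ := theorem1p4_general hm g h f hf
  exact ⟨ha, fun ℓ hℓ _ _ => hb ℓ hℓ, hc⟩
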